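/- **Setting.** *Hypersurfaces.* $L_\Sigma$ is a real vector space with a non-degenerate alternating form $\omega_\Sigma$; $L_\Sigma^{\mathbb C}$ is its complexification, with the complex bilinear extension of $\omega_\Sigma$. Orientation reversal gives $L_{\overline\Sigma}=L_\Sigma$, $\omega_{\overline\Sigma}=-\omega_\Sigma$, and disjoint unions give direct sums. A complex subspace $W\subseteq L_\Sigma^{\mathbb C}$ is Lagrangian if $W=\{y:\omega_\Sigma(x,y)=0\ \forall x\in W\}$. *Regions.* A region $M$ carries a complex vector space $K_M^{\mathbb C}$ of configurations, a subspace $L_M^{\mathbb C}\subseteq K_M^{\mathbb C}$ of solutions and an injective linear restriction map $r_M:L_M^{\mathbb C}\to L_{\partial M}^{\mathbb C}$ with Lagrangian image. It also carries a complex vector space of linear observables $D:K_M^{\mathbb C}\to\mathbb C$, and for each of these a non-empty affine subspace $A_M^{D}\subseteq K_M^{\mathbb C}$ with direction $L_M^{\mathbb C}$ (solutions for the action modified by $D$) and a restriction map $A_M^{D}\to L_{\partial M}^{\mathbb C}$, also written $r_M$, with $r_M(\eta+\varphi)=r_M(\eta)+r_M(\varphi)$ for $\varphi\in L_M^{\mathbb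 C}$, such that $A_M^0=L_M^{\mathbb C}$ with the same restriction map and $D(\varphi)=2\,\omega_{\partial M}(r_M\varphi,r_M\eta)$ for $\varphi\in L_M^{\mathbb C}$, $\eta\in A_M^D$. *Gluing.* Let $\partial M=\Sigma_1\cup\Sigma\cup\overline{\Sigma'}$ with $\Sigma'$ a copy of $\Sigma$, and let $M_1$, with $\partial M_1=\Sigma_1$, be obtained by gluing $\Sigma$ to $\Sigma'$. That is, there is a linear map $k:K_{M_1}^{\mathbb C}\to K_M^{\mathbb C}$, injective on $L_{M_1}^{\mathbb C}$, such that for each linear observable $D$ of $M$ the map $D_1:=D\circ k$ is a linear observable of $M_1$, $k(A_{M_1}^{D_1})$ is exactly the set of those $\eta\in A_M^{D}$ for which the components of $r_M(\eta)$ on $\Sigma$ and on $\overline{\Sigma'}$ agree, and for $\eta_1\in A_{M_1}^{D_1}$ the $\Sigma_1$-component of $r_M(k\eta_1)$ is $r_{M_1}(\eta_1)$. *Polarizations.* $P\subseteq L_{\partial M}^{\mathbb C}$ and $P_1\subseteq L_{\partial M_1}^{\mathbb C}$ are Lagrangian subspaces that are algebraic complements of $r_M(L_M^{\mathbb C})$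 and $r_{M_1}(L_{M_1}^{\mathbb C})$ respectively. For every $\varphi\in P_1$ there is $\psi\in L_\Sigma^{\mathbb C}$ with $(\varphi,\psi,\psi)\in P$. *Correlation functions.* For a linear observable $D$ of $M$ and $\zeta\in L_{\partial M}^{\mathbb C}$ let $\eta\in A_M^{D}$ be the unique element with $r_M(\eta)-\zeta\in P$. With $F=\exp(\mathrm iD)$, the correlation function of $F$ with the boundary Weyl observable $K^{P}_\zeta$ is $$\rho_M^F(K^{P}_\zeta)=\exp\Big(\tfrac{\mathrm i}{2}\big(D(\eta)+2\,\omega_{\partial M}(\zeta,\bar\eta)\big)\Big),\qquad \bar\eta=\tfrac12\big(r_M(\eta)+(r_M(\eta)-\zeta)\big),$$ and $\rho_M:=\rho_M^{1}$ is the case $D=0$. The same definitions apply to $M_1$ and $P_1$. *Integration.* Let $\alpha$ be a real structure (conjugate linear involution) on $L_\Sigma^{\mathbb C}$, not necessarily compatible with $\omega_\Sigma$. Let $L_\Sigma^\alpha$ be its fixed space and $g=g_\Sigma^\alpha$ a real inner product making $L_\Sigma^\alpha$ a separable Hilbert space. Let $\hat L_\Sigma^\alpha\supseteq L_\Sigma^\alpha$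 be the algebraic dual of the topological dual of $L_\Sigma^\alpha$, and $\nu$ the Gaussian probability measure on it (for the σ-algebra generated by the evaluations) for which every continuous linear functional $l$ on $L_\Sigma^\alpha$ is a centred Gaussian variable of variance $\|l\|^2$. For finite dimensional $N\subseteq L_\Sigma^\alpha$ let $P_N:\hat L_\Sigma^\alpha\to N$ be the canonical extension of the orthogonal projection. A function $f:L_\Sigma^\alpha\to\mathbb C$ is *integrable* (an element of $\mathrm L^1(\hat L_\Sigma^\alpha)$) if $f\circ P_N$ is in $\mathrm L^1(\nu)$ for all sufficiently large $N$ and converges in $\mathrm L^1(\nu)$ along the directed set of finite dimensional subspaces $N$; $\int_{\hat L_\Sigma^\alpha} f\,\mathrm d\nu$ is then the integral of the limit. The gluing is *admissible* if $\xi\mapsto\rho_M(K^{P}_{(0,\xi,\xi)})\exp(\tfrac12 g(\xi,\xi))$ is integrable, and then its integral is the *gluing anomaly factor* $$c(M;\Sigma,\overline{\Sigma'}):=\int_{\hat L_\Sigma^\alpha}\rho_M\big(K^{P}_{(0,\xi,\xi)}\big)\exp\big(\tfrac12 g(\xi,\xi)\big)\,\mathrm d\nu(\xi).$$ **Theorem.**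 In this setting suppose the gluing is admissible. Let $D:K_M^{\mathbb C}\to\mathbb C$ be a linear observable of $M$, $D_1$ the induced linear observable of $M_1$, $F=\exp(\mathrm iD)$, $F_1=\exp(\mathrm iD_1)$, and $\varphi\in L_{\partial M_1}^{\mathbb C}$. If $c(M;\Sigma,\overline{\Sigma'})\neq0$, then $\xi\mapsto\rho_M^F(K^{P}_{(\varphi,\xi,\xi)})\exp(\tfrac12 g(\xi,\xi))$ is integrable. Whenever this function is integrable (whether or not $c\ne0$), $$\rho_{M_1}^{F_1}\big(K^{P_1}_{\varphi}\big)\,c(M;\Sigma,\overline{\Sigma'})=\int_{\hat L_\Sigma^\alpha}\rho_M^F\big(K^{P}_{(\varphi,\xi,\xi)}\big)\exp\big(\tfrac12 g(\xi,\xi)\big)\,\mathrm d\nu(\xi).$$ No compatibility of $\alpha$ with $L_M^{\mathbb C}$ is assumed. -/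

import Mathlib

universe u v w

open MeasureTheory ProbabilityTheory Filter Topology
open scoped TensorProduct

/-! ## Classical linear field theory: hypersurfaces -/

/-- The space `L_Σ` of germs of solutions on a hypersurface: a real vector space with a
non-degenerate symplectic form. -/
structure PhaseSpace where
  carrier : Type u
  [addCommGroup : AddCommGroup carrier]
  [module : Module ℝ carrier]
  form : LinearMap.BilinForm ℝ carrier
  alt : form.IsAlt
  nondegenerate : form.Nondegenerate

namespace PhaseSpace

attribute [instance] PhaseSpace.addCommGroup PhaseSpace.module

/-- Orientation reversal: `L_{Σ̄} = L_Σ` and `ω_{Σ̄} = -ω_Σ`. -/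
def reverse (S : PhaseSpace.{u}) : PhaseSpace.{u} where
  carrier := S.carrier
  form := -S.form
  alt := fun x ↦ by simp [S.alt x]
  nondegenerate := by
    refine ⟨fun x hx ↦ S.nondegenerate.1 x fun y ↦ ?_, fun y hy ↦ S.nondegenerate.2 y fun x ↦ ?_⟩
    · simpa using hx y
    · simpa using hy x

/-- Union of hypersurfaces: `L_{Σ₁ ∪ Σ₂} = L_{Σ₁} ⊕ L_{Σ₂}` with the sum of the symplectic
forms. -/
def prod (S : PhaseSpace.{u}) (T : PhaseSpace.{v}) : PhaseSpace.{max u v} where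
  carrier := S.carrier × T.carrier
  form := S.form.compl₁₂ (LinearMap.fst ℝ _ _) (LinearMap.fst ℝ _ _) +
    T.form.compl₁₂ (LinearMap.snd ℝ _ _) (LinearMap.snd ℝ _ _)
  alt := fun x ↦ by simp [S.alt x.1, T.alt x.2]
  nondegenerate := by
    refine ⟨fun x hx ↦ Prod.ext (S.nondegenerate.1 _ fun y ↦ ?_) (T.nondegenerate.1 _ fun y ↦ ?_),
      fun x hx ↦ Prod.ext (S.nondegenerate.2 _ fun y ↦ ?_) (T.nondegenerate.2 _ fun y ↦ ?_)⟩
    · simpa using hx (y, 0)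
    · simpa using hx (0, y)
    · simpa using hx (y, 0)
    · simpa using hx (0, y)

section
variable (S : PhaseSpace.{u}) (T : PhaseSpace.{v})

/-- Projection `L_{Σ₁ ∪ Σ₂} → L_{Σ₁}`. -/
def fst : (S.prod T).carrier →ₗ[ℝ] S.carrier := LinearMap.fst ℝ S.carrier T.carrier

/-- Projection `L_{Σ₁ ∪ Σ₂} → L_{Σ₂}`. -/
def snd : (S.prod T).carrier →ₗ[ℝ] T.carrier := LinearMap.snd ℝ S.carrier T.carrier

/-- Inclusion `L_{Σ₁} → L_{Σ₁ ∪ Σ₂}`. -/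
def inl : S.carrier →ₗ[ℝ] (S.prod T).carrier := LinearMap.inl ℝ S.carrier T.carrier

/-- Inclusion `L_{Σ₂} → L_{Σ₁ ∪ Σ₂}`. -/
def inr : T.carrier →ₗ[ℝ] (S.prod T).carrier := LinearMap.inr ℝ S.carrier T.carrier

/-- The identification `L_Σ̄ = L_Σ`. -/
def ofReverse : S.reverse.carrier →ₗ[ℝ] S.carrier := LinearMap.id (M := S.carrier)

/-- The identification `L_Σ = L_Σ̄`. -/
def toReverse : S.carrier →ₗ[ℝ] S.reverse.carrier := LinearMap.id (M := S.carrier)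

end

/-- The complexification `L_Σ^ℂ`. -/
def Cx (S : PhaseSpace.{u}) : Type u := ℂ ⊗[ℝ] S.carrier

noncomputable instance (S : PhaseSpace.{u}) : AddCommGroup S.Cx :=
  inferInstanceAs (AddCommGroup (ℂ ⊗[ℝ] S.carrier))

noncomputable instance (S : PhaseSpace.{u}) : Module ℂ S.Cx :=
  inferInstanceAs (Module ℂ (ℂ ⊗[ℝ] S.carrier))

/-- The complex bilinear extension of the symplectic form to `L_Σ^ℂ`. -/
noncomputable def formC (S : PhaseSpace.{u}) : LinearMap.BilinForm ℂ S.Cx :=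
  LinearMap.BilinForm.baseChange ℂ S.form

/-- Complex linear extension of a real linear map. -/
noncomputable def mapC {S : PhaseSpace.{u}} {T : PhaseSpace.{v}} (f : S.carrier →ₗ[ℝ] T.carrier) :
    S.Cx →ₗ[ℂ] T.Cx :=
  LinearMap.baseChange ℂ f

/-- Complex Lagrangian subspace: isotropic and coisotropic. -/
def IsLagrangian (S : PhaseSpace.{u}) (W : Submodule ℂ S.Cx) : Prop :=
  (∀ x ∈ W, ∀ y ∈ W, S.formC x y = 0) ∧ ∀ y, (∀ x ∈ W, S.formC x y = 0) → y ∈ W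

/-! ### The boundary `Σ₁ ∪ Σ ∪ Σ̄'` with `Σ'` a copy of `Σ` -/

/-- `L_{∂M} = L_{Σ₁} ⊕ L_Σ ⊕ L_{Σ̄'}` with `Σ'` a copy of `Σ`. -/
abbrev glued (S₁ : PhaseSpace.{u}) (S : PhaseSpace.{v}) : PhaseSpace.{max u v} :=
  S₁.prod (S.prod S.reverse)

section
variable (S₁ : PhaseSpace.{u}) (S : PhaseSpace.{v})

/-- Complexified projection `L_{∂M} → L_{Σ₁}`. -/
noncomputable def projFst : (glued S₁ S).Cx →ₗ[ℂ] S₁.Cx := mapC (S₁.fst _)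

/-- Complexified projection `L_{∂M} → L_Σ`. -/
noncomputable def projMid : (glued S₁ S).Cx →ₗ[ℂ] S.Cx := mapC (S.fst _ ∘ₗ S₁.snd _)

/-- Complexified projection `L_{∂M} → L_{Σ̄'}`, the latter identified with `L_Σ`. -/
noncomputable def projLast : (glued S₁ S).Cx →ₗ[ℂ] S.Cx :=
  mapC (S.ofReverse ∘ₗ S.snd S.reverse ∘ₗ S₁.snd _)

variable {S₁ S}

/-- The element `(φ, ξ, ξ')` of `L_{∂M}^ℂ = L_{Σ₁}^ℂ ⊕ L_Σ^ℂ ⊕ L_{Σ̄'}^ℂ`. -/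
noncomputable def triple (φ : S₁.Cx) (ξ ξ' : S.Cx) : (glued S₁ S).Cx :=
  mapC (S₁.inl (S.prod S.reverse)) φ + mapC (S₁.inr _ ∘ₗ S.inl S.reverse) ξ +
    mapC (S₁.inr _ ∘ₗ S.inr S.reverse ∘ₗ S.toReverse) ξ'

end

end PhaseSpace

/-! ## Classical linear field theory: regions and linear observables -/

/-- The classical data of a region `M` whose boundary has the space of germs `S = L_{∂M}`. -/
structure Region (S : PhaseSpace.{u}) where
  /-- The space `K_M^ℂ` of complexified field configurations. -/
  Conf : Type v
  [addCommGroup : AddCommGroup Conf]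
  [module : Module ℂ Conf]
  /-- The space `L_M^ℂ` of solutions of the (homogeneous) equations of motion. -/
  Sol : Submodule ℂ Conf
  /-- Restriction of solutions to germs on the boundary. -/
  r : Sol →ₗ[ℂ] S.Cx
  r_injective : Function.Injective r
  r_lagrangian : S.IsLagrangian (LinearMap.range r)
  /-- The linear observables `D : K_M^ℂ → ℂ` of the theory. -/
  linObs : Submodule ℂ (Module.Dual ℂ Conf)
  /-- `A_M^{D,ℂ}`: solutions of the equations of motion modified by adding `D` to the action. -/
  A : linObs → AffineSubspace ℂ Conf
  A_nonempty : ∀ D, (A D : Set Conf).Nonempty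
  A_direction : ∀ D, (A D).direction = Sol
  /-- Restriction of the modified solutions to germs on the boundary. -/
  bdry : ∀ D, A D → S.Cx
  bdry_add : ∀ D (η η' : A D) (φ : Sol), (η' : Conf) = η + φ → bdry D η' = bdry D η + r φ
  A_zero : A 0 = Sol.toAffineSubspace
  bdry_zero : ∀ (η : A 0) (φ : Sol), (η : Conf) = φ → bdry 0 η = r φ
  /-- `D(φ) = 2 ω_{∂M}(φ, η)` for `φ ∈ L_M^ℂ` and `η ∈ A_M^{D,ℂ}`. -/
  obs_eq : ∀ (D : linObs) (φ : Sol) (η : A D), D.1 φ = 2 * S.formC (r φ) (bdry D η)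

attribute [instance] Region.addCommGroup Region.module

namespace Region

variable {S : PhaseSpace.{u}} (M : Region.{u, v} S)

/-- The subspace `L_{M̃}^ℂ ⊆ L_{∂M}^ℂ` of germs that come from solutions in the interior. -/
noncomputable def interior : Submodule ℂ S.Cx := LinearMap.range M.r

/-- A polarization on `∂M` that is transversal to the interior solutions. -/
structure Polarization where
  carrier : Submodule ℂ S.Cx
  lagrangian : S.IsLagrangian carrier
  transversal : IsCompl M.interior carrier

variable {M}

/-- Transversality yields a unique modified solution in the interior that jumps by `ξ` across the
boundary to an exterior germ in the polarization. -/
theorem existsUnique_solution (P : M.Polarization) (D : M.linObs) (ξ : S.Cx) :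
    ∃! η : M.A D, M.bdry D η - ξ ∈ P.carrier := by
  obtain ⟨η₀, h₀⟩ := M.A_nonempty D
  have hmem : M.bdry D ⟨η₀, h₀⟩ - ξ ∈ M.interior ⊔ P.carrier := by
    rw [P.transversal.sup_eq_top]; trivial
  obtain ⟨_, ⟨a, rfl⟩, p, hp, hsum⟩ := Submodule.mem_sup.1 hmem
  have hmove : ∀ φ : M.Sol, η₀ + (φ : M.Conf) ∈ M.A D := fun φ ↦ by
    have := AffineSubspace.vadd_mem_of_mem_direction
      (s := M.A D) (v := (φ : M.Conf)) (by rw [M.A_direction]; exact φ.2) h₀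
    rwa [vadd_eq_add, add_comm] at this
  refine ⟨⟨η₀ + ((-a : M.Sol) : M.Conf), hmove _⟩, ?_, ?_⟩
  · change M.bdry D _ - ξ ∈ P.carrier
    rw [M.bdry_add D ⟨η₀, h₀⟩ _ (-a) rfl, map_neg]
    convert hp using 1
    rw [eq_sub_of_add_eq' hsum]; abel
  · rintro ⟨η', h'⟩ hη'
    have hd : η' - η₀ ∈ M.Sol := by
      rw [← M.A_direction D]; exact AffineSubspace.vsub_mem_direction h' h₀
    have hb := M.bdry_add D ⟨η₀, h₀⟩ ⟨η', h'⟩ ⟨η' - η₀, hd⟩ (by simp)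
    have hz : M.r (⟨η' - η₀, hd⟩ + a) ∈ M.interior ⊓ P.carrier := by
      refine ⟨⟨_, rfl⟩, ?_⟩
      have hq := P.carrier.sub_mem hη' hp
      have e : M.r (⟨η' - η₀, hd⟩ + a) = (M.bdry D ⟨η', h'⟩ - ξ) - p := by
        rw [map_add, hb, eq_sub_of_add_eq' hsum]; abel
      change _ ∈ P.carrier
      rw [e]; exact hq
    rw [P.transversal.inf_eq_bot, Submodule.mem_bot, ← map_zero M.r] at hz
    have h0 := congrArg (Subtype.val) (M.r_injective hz)
    refine Subtype.ext ?_
    simp only [Submodule.coe_add, Submodule.coe_zero] at h0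
    change η' = η₀ + ((-a : M.Sol) : M.Conf)
    rw [Submodule.coe_neg, ← sub_eq_zero, ← h0]; abel

/-- The linear observable on the slice region of `∂M` determined by `ξ`: evaluated on a pair of
boundary values it is `2 ω(ξ, ·)` of their average. -/
noncomputable def sliceObs (ξ : S.Cx) (φ₁ φ₂ : S.Cx) : ℂ :=
  2 * S.formC ξ ((1 / 2 : ℂ) • (φ₁ + φ₂))

/-- The interior part `φ_M ∈ A_M^{D,ℂ}` of the solution for the action modified by both `D` and the
boundary slice observable `E` determined by `ξ`, with exterior part `φ_X = φ_M - ξ` in the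
polarization. -/
noncomputable def solution (P : M.Polarization) (D : M.linObs) (ξ : S.Cx) : M.A D :=
  (existsUnique_solution P D ξ).choose

/-- The correlation function `ρ_M^F(K_ξ^P) = exp((i/2) (D + E)(φ))` of the Weyl observable
`F = exp(i D)` with the boundary Weyl slice observable `exp(i E)` determined by `ξ`. Here `φ` is the
solution for the action modified by `D + E` with boundary condition `P`. -/
noncomputable def corr (P : M.Polarization) (D : M.linObs) (ξ : S.Cx) : ℂ :=
  Complex.exp (Complex.I / 2 *
    (D.1 (solution P D ξ : M.Conf) +
      sliceObs ξ (M.bdry D (solution P D ξ) - ξ) (M.bdry D (solution P D ξ))))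

/-- The amplitude `ρ_M(K_ξ^P)`: no observable in the interior, `F = 1 = exp(i 0)`. -/
noncomputable def ampl (P : M.Polarization) (ξ : S.Cx) : ℂ := corr P 0 ξ

end Region

open PhaseSpace in
/-- `M₁` is the gluing of `M` to itself along `Σ` and `Σ̄'`, where `∂M = Σ₁ ∪ Σ ∪ Σ̄'` and
`∂M₁ = Σ₁`. -/
structure Gluing {S₁ : PhaseSpace.{u}} {S : PhaseSpace.{u}} (M : Region.{u, v} (glued S₁ S))
    (M₁ : Region.{u, w} S₁) where
  /-- Field configurations in `M₁` yield field configurations in `M`. -/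
  k : M₁.Conf →ₗ[ℂ] M.Conf
  injOn : Set.InjOn k M₁.Sol
  /-- A linear observable `D` in `M` induces the linear observable `D₁ = D ∘ k` in `M₁`. -/
  comp_mem : ∀ D ∈ M.linObs, D ∘ₗ k ∈ M₁.linObs
  mapsTo : ∀ D (η₁ : M₁.A ⟨D.1 ∘ₗ k, comp_mem D.1 D.2⟩), k η₁ ∈ M.A D
  /-- Exactness of `A_{M₁}^{D₁} ↪ A_M^D ⇉ L_Σ^ℂ`; for `D = 0` this is `L_{M₁} ↪ L_M ⇉ L_Σ`. -/
  exact : ∀ D (η : M.A D), projMid S₁ S (M.bdry D η) = projLast S₁ S (M.bdry D η) ↔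
    ∃ η₁ : M₁.A ⟨D.1 ∘ₗ k, comp_mem D.1 D.2⟩, k η₁ = η
  /-- Compatibility with the projection `L_{∂M}^ℂ → L_{∂M₁}^ℂ`. -/
  proj_bdry : ∀ D (η₁ : M₁.A ⟨D.1 ∘ₗ k, comp_mem D.1 D.2⟩),
    projFst S₁ S (M.bdry D ⟨k η₁, mapsTo D η₁⟩) = M₁.bdry _ η₁

namespace Gluing

variable {S₁ S : PhaseSpace.{u}} {M : Region.{u, v} (PhaseSpace.glued S₁ S)}
  {M₁ : Region.{u, w} S₁}

/-- The linear observable in `M₁` induced by a linear observable in `M`. -/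
def induced (G : Gluing M M₁) (D : M.linObs) : M₁.linObs := ⟨D.1 ∘ₗ G.k, G.comp_mem D.1 D.2⟩

end Gluing

/-! ## Real structures -/

/-- A real structure on a complex vector space: a conjugate linear involution. -/
structure RealStructure (V : Type u) [AddCommGroup V] [Module ℂ V] where
  toMap : V →ₛₗ[starRingEnd ℂ] V
  involutive : Function.Involutive toMap

/-- The real subspace `V^α` of the vectors fixed by the real structure `α`. -/
def RealStructure.fixed {V : Type u} [AddCommGroup V] [Module ℂ V] (α : RealStructure V) :
    Submodule ℝ V where
  carrier := {x | α.toMap x = x}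
  add_mem' := fun {x y} hx hy ↦ by
    change α.toMap (x + y) = x + y
    rw [map_add, show α.toMap x = x from hx, show α.toMap y = y from hy]
  zero_mem' := map_zero _
  smul_mem' := fun t x hx ↦ by
    change α.toMap ((t : ℂ) • x) = (t : ℂ) • x
    rw [LinearMap.map_smulₛₗ, Complex.conj_ofReal, show α.toMap x = x from hx]

/-! ## The Gaussian measure on an extension of a Hilbert space -/

/-- The extension `Ĥ` of a real Hilbert space `H`: the algebraic dual of its topological dual. A
vector `h` of `H` is identified with the functional `l ↦ l h`. -/
def HatSpace (H : Type u) [NormedAddCommGroup H] [InnerProductSpace ℝ H] : Type u :=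
  Module.Dual ℝ (StrongDual ℝ H)

namespace HatSpace
variable {H : Type*} [NormedAddCommGroup H] [InnerProductSpace ℝ H]

/-- Evaluation of a point of `Ĥ` on a continuous functional. -/
def eval (l : StrongDual ℝ H) (x : HatSpace H) : ℝ := (show Module.Dual ℝ (StrongDual ℝ H) from x) l

/-- The σ-algebra generated by the evaluations. -/
instance : MeasurableSpace (HatSpace H) := ⨆ l, MeasurableSpace.comap (eval l) inferInstance

theorem measurable_eval (l : StrongDual ℝ H) : Measurable (eval l) :=
  Measurable.of_comap_le (le_iSup (fun l : StrongDual ℝ H ↦ MeasurableSpace.comap (eval l) inferInstance) l)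

theorem measurable_of_eval {Ω : Type*} [MeasurableSpace Ω] {T : Ω → HatSpace H}
    (h : ∀ l, Measurable fun ω ↦ eval l (T ω)) : Measurable T := by
  rw [measurable_iff_comap_le]
  change MeasurableSpace.comap T (⨆ l, MeasurableSpace.comap (eval l) inferInstance) ≤ _
  rw [MeasurableSpace.comap_iSup]
  refine iSup_le fun l ↦ ?_
  rw [MeasurableSpace.comap_comp]
  exact (h l).comap_le

/-- An isonormal Gaussian family indexed by `H`. -/
theorem exists_isonormal (H : Type u) [NormedAddCommGroup H] [InnerProductSpace ℝ H] [CompleteSpace H] :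
    ∃ (Ω : Type u) (_ : MeasurableSpace Ω) (P : Measure Ω) (_ : IsProbabilityMeasure P)
      (W : H →ₗᵢ[ℝ] Lp ℝ 2 P), ∀ h, P.map (W h) = gaussianReal 0 (‖h‖₊ ^ 2) := by
  obtain ⟨w, b, -⟩ := exists_hilbertBasis ℝ H
  obtain ⟨Ω, mΩ, P, X, hXm, hXl, hXi, hP⟩ := exists_iid w (gaussianReal 0 1)
  have hg : ∀ i, HasGaussianLaw (X i) P := fun i ↦ (hXl i).hasGaussianLaw
  have hL : ∀ i, MemLp (X i) 2 P := fun i ↦ (hg i).memLp_two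
  have hmean : ∀ i, ∫ ω, X i ω ∂P = 0 := fun i ↦ by
    rw [(hXl i).integral_eq]; exact integral_id_gaussianReal
  have hvar : ∀ i, ∫ ω, X i ω * X i ω ∂P = 1 := fun i ↦ by
    have h1 : Var[X i; P] = 1 := by rw [(hXl i).variance_eq]; simp
    rw [variance_eq_integral (hXm i).aemeasurable, hmean] at h1
    simpa [sq] using h1
  have horth : Orthonormal ℝ (fun i ↦ (hL i).toLp (X i)) := by
    classical
    rw [orthonormal_iff_ite]
    intro i j
    have e : inner ℝ ((hL i).toLp (X i)) ((hL j).toLp (X j)) = ∫ ω, X i ω * X j ω ∂P := by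
      rw [L2.inner_def]
      refine integral_congr_ae ?_
      filter_upwards [(hL i).coeFn_toLp, (hL j).coeFn_toLp] with ω h1 h2
      rw [h1, h2]; simp [mul_comm]
    rw [e]
    split_ifs with hij
    · subst hij; exact hvar i
    · have := (hXi.indepFun hij).integral_fun_mul_eq_mul_integral
        (hXm i).aestronglyMeasurable (hXm j).aestronglyMeasurable
      rw [this, hmean, zero_mul]
  let V : H →ₗᵢ[ℝ] Lp ℝ 2 P :=
    horth.orthogonalFamily.linearIsometry.comp b.repr.toLinearIsometry
  refine ⟨Ω, mΩ, P, hP, V, ?_⟩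
  have hVb : ∀ i, V (b i) = (hL i).toLp (X i) := by
    classical
    intro i
    simp only [V, LinearIsometry.coe_comp, Function.comp_apply, LinearIsometryEquiv.coe_toLinearIsometry, b.repr_self]
    rw [OrthogonalFamily.linearIsometry_apply_single]
    simp
  -- characteristic functional
  have hcf : ∀ h : H, ∫ ω, Complex.exp (V h ω * Complex.I) ∂P = Complex.exp (-(‖h‖ ^ 2 / 2 : ℝ)) := by
    have hcont : Continuous fun h : H ↦ ∫ ω, Complex.exp (V h ω * Complex.I) ∂P := by
      have hint : ∀ h : H, Integrable (fun ω ↦ Complex.exp (V h ω * Complex.I)) P := fun h ↦ by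
        refine Integrable.of_bound (C := 1) ?_ (Eventually.of_forall fun ω ↦ by rw [Complex.norm_exp_ofReal_mul_I])
        exact (((Complex.measurable_ofReal.comp (Lp.stronglyMeasurable (V h)).measurable).mul_const _).cexp).aestronglyMeasurable
      have hLip : ∀ h k : H, dist (∫ ω, Complex.exp (V h ω * Complex.I) ∂P)
          (∫ ω, Complex.exp (V k ω * Complex.I) ∂P) ≤ dist h k := by
        intro h k
        rw [dist_eq_norm, ← integral_sub (hint h) (hint k)]
        have hm : MemLp (V (h - k)) 2 P := Lp.memLp _
        calc ‖∫ ω, (Complex.exp (V h ω * Complex.I) - Complex.exp (V k ω * Complex.I)) ∂P‖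
            ≤ ∫ ω, ‖V (h - k) ω‖ ∂P := by
              refine norm_integral_le_of_norm_le (hm.integrable (by norm_num)).norm ?_
              have hs : V (h - k) = V h - V k := map_sub _ _ _
              filter_upwards [Lp.coeFn_sub (V h) (V k)] with ω hω
              rw [hs, hω, Pi.sub_apply]
              have := Real.norm_exp_I_mul_ofReal_sub_one_le (x := V h ω - V k ω)
              have e2 : Complex.exp (V h ω * Complex.I) - Complex.exp (V k ω * Complex.I)
                = Complex.exp (V k ω * Complex.I) * (Complex.exp (Complex.I * ((V h ω - V k ω : ℝ) : ℂ)) - 1) := by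
                rw [mul_sub, ← Complex.exp_add, mul_one]; congr 2; push_cast; ring
              rw [e2, norm_mul, Complex.norm_exp_ofReal_mul_I, one_mul]
              exact this
          _ ≤ ‖V (h - k)‖ := by
              rw [Lp.norm_def]
              have h1 : eLpNorm (V (h - k)) 1 P ≤ eLpNorm (V (h - k)) 2 P :=
                eLpNorm_le_eLpNorm_of_exponent_le (by norm_num) hm.1
              rw [integral_norm_eq_lintegral_enorm hm.1, ← eLpNorm_one_eq_lintegral_enorm]
              exact ENNReal.toReal_mono hm.2.ne h1
          _ = dist h k := by rw [V.norm_map, dist_eq_norm]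
      exact (LipschitzWith.of_dist_le_mul (K := 1) (by simpa using hLip)).continuous
    have hcont2 : Continuous fun h : H ↦ Complex.exp (-(‖h‖ ^ 2 / 2 : ℝ)) := by fun_prop
    intro h
    have hlim := b.hasSum_repr h
    refine tendsto_nhds_unique ((hcont.tendsto h).comp hlim) ?_
    refine ((hcont2.tendsto h).comp hlim).congr fun s ↦ ?_
    simp only [Function.comp_apply]
    set c : w → ℝ := fun i ↦ b.repr h i
    have hae : (V (∑ i ∈ s, c i • b i) : Ω → ℝ) =ᵐ[P] fun ω ↦ ∑ i ∈ s, c i * X i ω := by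
      rw [map_sum]
      refine (Lp.coeFn_finsetSum _ _).trans ?_
      have : ∀ i ∈ s, (V (c i • b i) : Ω → ℝ) =ᵐ[P] fun ω ↦ c i * X i ω := fun i _ ↦ by
        rw [map_smul, hVb]
        filter_upwards [Lp.coeFn_smul (c i) ((hL i).toLp (X i)), (hL i).coeFn_toLp] with ω h1 h2
        rw [h1, Pi.smul_apply, h2, smul_eq_mul]
      have h2 := (eventually_all_finset s).2 this
      filter_upwards [h2] with ω hω
      rw [Finset.sum_apply]
      exact Finset.sum_congr rfl fun i hi ↦ hω i hi
    have hn : ‖∑ i ∈ s, c i • b i‖ ^ 2 = ∑ i ∈ s, c i ^ 2 := by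
      rw [← real_inner_self_eq_norm_sq, b.orthonormal.inner_sum]
      simp [sq]
    rw [hn, integral_congr_ae (g := fun ω ↦ ∏ i ∈ s, Complex.exp (((c i * X i ω : ℝ) : ℂ) * Complex.I))]
    · have hind : iIndepFun (fun i ω ↦ c i * X i ω) P :=
        hXi.comp (fun i x ↦ c i * x) fun i ↦ by fun_prop
      have hmeas : ∀ i, Measurable fun ω ↦ c i * X i ω := fun i ↦ (hXm i).const_mul _
      have key := (hind.precomp Subtype.val_injective).charFun_map_fun_finsetSum_eq_prod (s := s)
        (P := P) (X := fun i ω ↦ c i * X i ω) fun i _ ↦ (hmeas i).aemeasurable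
      have key1 := congrFun key 1
      rw [charFun_apply_real, integral_map (by fun_prop) (by fun_prop), Finset.prod_apply] at key1
      have hlaw : ∀ i, charFun (P.map fun ω ↦ c i * X i ω) 1 = Complex.exp (-(c i ^ 2 / 2 : ℝ)) := by
        intro i
        rw [(gaussianReal_const_mul (hXl i) (c i)).map_eq, charFun_gaussianReal]
        simp
      simp_rw [hlaw] at key1
      rw [← Complex.exp_sum] at key1
      symm
      calc ∫ ω, ∏ i ∈ s, Complex.exp (((c i * X i ω : ℝ) : ℂ) * Complex.I) ∂P = _ := by
            refine Eq.trans (integral_congr_ae (Eventually.of_forall fun ω ↦ ?_)) key1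
            simp only
            rw [← Complex.exp_sum, ← Finset.sum_mul]; push_cast; rw [one_mul]
        _ = _ := by
            congr 1
            push_cast
            rw [Finset.sum_neg_distrib, Finset.sum_div]
    · filter_upwards [hae] with ω hω
      rw [hω, ← Complex.exp_sum, ← Finset.sum_mul]; push_cast; rfl
  intro h
  refine Measure.ext_of_charFun (funext fun t ↦ ?_)
  have hVm : Measurable (V h) := (Lp.stronglyMeasurable (V h)).measurable
  rw [charFun_apply_real, integral_map hVm.aemeasurable (by fun_prop), charFun_gaussianReal]
  have h1 := hcf (t • h)
  rw [integral_congr_ae (g := fun ω ↦ Complex.exp (t * V h ω * Complex.I))] at h1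
  · rw [h1, norm_smul]
    congr 1
    push_cast
    rw [mul_pow, ← Complex.ofReal_pow ‖t‖, Real.norm_eq_abs, sq_abs]
    push_cast
    ring
  · rw [map_smul]
    filter_upwards [Lp.coeFn_smul t (V h)] with ω hω
    rw [hω, Pi.smul_apply, smul_eq_mul]; push_cast; rfl

theorem exists_gaussianMeasure (H : Type u) [NormedAddCommGroup H] [InnerProductSpace ℝ H]
    [CompleteSpace H] : ∃ ν : Measure (HatSpace H), IsProbabilityMeasure ν ∧
      ∀ l : StrongDual ℝ H, ν.map (eval l) = gaussianReal 0 (‖l‖₊ ^ 2) := by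
  obtain ⟨Ω, mΩ, P, hP, W, hW⟩ := exists_isonormal H
  let W' : StrongDual ℝ H →ₗ[ℝ] Lp ℝ 2 P :=
    { toFun := fun l ↦ W ((InnerProductSpace.toDual ℝ H).symm l)
      map_add' := by simp
      map_smul' := by simp }
  let B := Module.Basis.ofVectorSpace ℝ (StrongDual ℝ H)
  let T : Ω → HatSpace H := fun ω ↦ (B.constr ℝ fun i ↦ (W' (B i) : Ω → ℝ) ω : Module.Dual ℝ (StrongDual ℝ H))
  have hTl : ∀ l, (fun ω ↦ eval l (T ω)) = fun ω ↦ ∑ i ∈ (B.repr l).support, B.repr l i * (W' (B i) : Ω → ℝ) ω := by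
    intro l
    funext ω
    change (B.constr ℝ fun i ↦ (W' (B i) : Ω → ℝ) ω) l = _
    rw [Module.Basis.constr_apply, Finsupp.sum]
    rfl
  have hTm : Measurable T := measurable_of_eval fun l ↦ by
    rw [hTl]
    exact Finset.measurable_sum _ fun i _ ↦ (Lp.stronglyMeasurable (W' (B i))).measurable.const_mul _
  have hae : ∀ l, (fun ω ↦ eval l (T ω)) =ᵐ[P] W' l := by
    intro l
    rw [hTl]
    have hl : W' l = ∑ i ∈ (B.repr l).support, B.repr l i • W' (B i) := by
      conv_lhs => rw [← B.linearCombination_repr l, Finsupp.linearCombination_apply, Finsupp.sum, map_sum]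
      simp
    rw [hl]
    refine EventuallyEq.symm ((Lp.coeFn_finsetSum _ _).trans ?_)
    have h2 := (eventually_all_finset (B.repr l).support).2 fun i _ ↦ Lp.coeFn_smul (B.repr l i) (W' (B i))
    filter_upwards [h2] with ω hω
    rw [Finset.sum_apply]
    exact Finset.sum_congr rfl fun i hi ↦ by rw [hω i hi]; rfl
  refine ⟨P.map T, Measure.isProbabilityMeasure_map hTm.aemeasurable, fun l ↦ ?_⟩
  rw [Measure.map_map (measurable_eval l) hTm]
  change P.map (fun ω ↦ eval l (T ω)) = _
  rw [Measure.map_congr (hae l)]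
  have := hW ((InnerProductSpace.toDual ℝ H).symm l)
  rw [LinearIsometryEquiv.nnnorm_map] at this
  exact this

/-- The Gaussian probability measure `ν` on `Ĥ` determined by the inner product of `H`: every
continuous functional `l` is a centred Gaussian variable with variance `‖l‖²`. As the σ-algebra is
generated by the evaluations, and the `l` form a vector space, this determines `ν`. -/
noncomputable def gaussian (H : Type u) [NormedAddCommGroup H] [InnerProductSpace ℝ H]
    [CompleteSpace H] : Measure (HatSpace H) :=
  (exists_gaussianMeasure H).choose

section
variable [CompleteSpace H]

instance : IsProbabilityMeasure (gaussian H) := (exists_gaussianMeasure H).choose_spec.1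

theorem map_eval_gaussian (l : StrongDual ℝ H) :
    (gaussian H).map (eval l) = gaussianReal 0 (‖l‖₊ ^ 2) :=
  (exists_gaussianMeasure H).choose_spec.2 l

end

/-- The finite dimensional subspaces of `H`, ordered by inclusion. -/
abbrev FinSub (H : Type u) [NormedAddCommGroup H] [InnerProductSpace ℝ H] : Type u :=
  {N : Submodule ℝ H // FiniteDimensional ℝ N}

instance : SemilatticeSup (FinSub H) :=
  Subtype.semilatticeSup fun {N N'} (_ : FiniteDimensional ℝ N) (_ : FiniteDimensional ℝ N') ↦
    (inferInstance : FiniteDimensional ℝ ↥(N ⊔ N'))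

instance : Nonempty (FinSub H) := ⟨⟨⊥, inferInstance⟩⟩

/-- The extension to `Ĥ` of the orthogonal projection onto the finite dimensional subspace `N`:
`x ↦ ∑ i, x(⟨eᵢ, ·⟩) eᵢ` for an orthonormal basis `(eᵢ)` of `N`. -/
noncomputable def proj (N : FinSub H) (x : HatSpace H) : H :=
  haveI := N.2
  ∑ i, eval (innerSL ℝ (stdOrthonormalBasis ℝ N.1 i : H)) x • (stdOrthonormalBasis ℝ N.1 i : H)

variable [CompleteSpace H]

/-- `F` is the extension to `Ĥ`, as an element of `L¹(Ĥ, ν)`, of the function `f` on `H`: it is the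
limit in `L¹(Ĥ, ν)` of the cylinder functions `f ∘ P_N` along the directed set of the finite
dimensional subspaces `N` of `H`. -/
structure IsL1Extension (f : H → ℂ) (F : HatSpace H → ℂ) : Prop where
  integrable : Integrable F (gaussian H)
  integrable_cylinder : ∀ᶠ N : FinSub H in atTop, Integrable (fun x ↦ f (proj N x)) (gaussian H)
  tendsto : Tendsto (fun N : FinSub H ↦ ∫ x, ‖f (proj N x) - F x‖ ∂(gaussian H)) atTop (𝓝 0)

/-- The function `f` on `H` is (extends to) an element of `L¹(Ĥ, ν)`. -/
def HatIntegrable (f : H → ℂ) : Prop := ∃ F : HatSpace H → ℂ, IsL1Extension f F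

open Classical in
/-- The integral over `Ĥ` of (the extension of) the function `f` on `H`, with the value `0` if `f`
is not integrable. -/
noncomputable def hatIntegral (f : H → ℂ) : ℂ :=
  if h : HatIntegrable f then ∫ x, h.choose x ∂(gaussian H) else 0

end HatSpace

/-! ## The integrand of the composition rule -/

/-- The function `ξ ↦ ρ_M^F(K^P_{(φ,ξ,ξ)}) exp(½ g(ξ,ξ))` on `L_Σ^α`, where `F = exp(i D)`. The
inner product `g` on `L_Σ^α` is that of the Hilbert space `H`, identified with `L_Σ^α` by `e`. -/
noncomputable def glueIntegrand {S₁ S : PhaseSpace.{u}} {M : Region.{u, v} (PhaseSpace.glued S₁ S)}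
    (P : M.Polarization) {α : RealStructure S.Cx} {H : Type u} [NormedAddCommGroup H]
    [InnerProductSpace ℝ H] (e : H ≃ₗ[ℝ] α.fixed) (D : M.linObs) (φ : S₁.Cx) (ξ : H) : ℂ :=
  Region.corr P D (PhaseSpace.triple φ (e ξ : S.Cx) (e ξ : S.Cx)) *
    Complex.exp (1 / 2 * (inner ℝ ξ ξ : ℝ))

/-- Admissibility of the gluing: `ξ ↦ ρ_M(K^P_{(0,ξ,ξ)}) exp(½ g(ξ,ξ))` is integrable. -/
def AdmissibleGluing {S₁ S : PhaseSpace.{u}} {M : Region.{u, v} (PhaseSpace.glued S₁ S)}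
    (P : M.Polarization) {α : RealStructure S.Cx} {H : Type u} [NormedAddCommGroup H]
    [InnerProductSpace ℝ H] [CompleteSpace H] (e : H ≃ₗ[ℝ] α.fixed) : Prop :=
  HatSpace.HatIntegrable (glueIntegrand P e 0 0)

/-- The gluing anomaly factor `c(M; Σ, Σ̄')`. -/
noncomputable def gluingAnomaly {S₁ S : PhaseSpace.{u}}
    {M : Region.{u, v} (PhaseSpace.glued S₁ S)} (P : M.Polarization) {α : RealStructure S.Cx}
    {H : Type u} [NormedAddCommGroup H] [InnerProductSpace ℝ H] [CompleteSpace H]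
    (e : H ≃ₗ[ℝ] α.fixed) : ℂ :=
  HatSpace.hatIntegral (glueIntegrand P e 0 0)

/-! ## Exponential integrals depending on a complex parameter -/

section ExponentialIntegrals

variable {Ω : Type*} [MeasurableSpace Ω] {μ : Measure Ω}

/-! The integrand is a complex translate of the integrand of the anomaly factor, and the Gaussian
integrals in question are invariant under complex translations.

Algebra. Let `π` be the projection onto interior solutions along the polarization. Since both
subspaces are isotropic, `ω(ζ, π ζ')` is symmetric on the isotropic diagonal `(0, ξ, ξ)`, and the
amplitude there is `exp(-Q(ξ,ξ)/2)` for a symmetric complex form `Q`. The modified solution of the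
glued region, regarded in `M`, solves the boundary problem for some `(φ, ξ₀, ξ₀)`. Its components on
the two copies of `Σ` agree, so the term linear in `ξ - ξ₀` vanishes, and the correlation function
is `ρ_{M₁}` times `exp(-Q(ξ-ξ₀,ξ-ξ₀)/2)` (`Gluing.corr_diagonal`). In general `ξ₀ = a + i b` with
`a`, `b` fixed by `α`, so the translation is complex (`exists_glueIntegrand_eq`).

Equality of integrals. The weight `exp(g/2)` cancels the Gaussian density, so real translations act
as for Lebesgue measure; this is the Cameron-Martin formula `map_translate_gaussian`. Analytic
continuation extends the invariance to complex translations on each finite dimensional `N`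
containing `a` and `b` (`integral_gaussFn_mul_exp`). If both limits over `N` exist, they agree
(`hatIntegral_complexShift`).

Integrability. Real translations are isometric in L¹, so they preserve Cauchy nets. Imaginary ones
are not isometric: they enlarge L¹ norms by an amount depending on the imaginary part of `Q`
measured by its real part. If `c ≠ 0`, this amount is bounded uniformly in `N`
(`exists_eventually_re_le`): translations are L¹-continuous uniformly in `N`, whereas a rapidly
oscillating factor would separate a translate from the original. The three lines theorem, with
isometric real translations on one edge and this bound on the other, then gives the Cauchy property
(`integral_norm_sub_le_interp`, `hatIntegrable_gaussFn_mul_exp`). -/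

theorem norm_exp_mul_le (t z : ℂ) : ‖Complex.exp (t * z)‖ ≤ Real.exp (‖t‖ * ‖z‖) := by
  rw [Complex.norm_exp]
  exact Real.exp_le_exp.2 ((Complex.re_le_norm _).trans (norm_mul_le _ _))

theorem integrable_mul_exp {F X : Ω → ℂ} (hF : AEStronglyMeasurable F μ)
    (hX : AEStronglyMeasurable X μ)
    (h : ∀ R : ℝ, Integrable (fun x ↦ ‖F x‖ * Real.exp (R * ‖X x‖)) μ) (t : ℂ) :
    Integrable (fun x ↦ F x * Complex.exp (t * X x)) μ := by
  refine (h ‖t‖).mono' (hF.mul (Complex.continuous_exp.comp_aestronglyMeasurable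
    (hX.const_mul t))) (Eventually.of_forall fun x ↦ ?_)
  rw [norm_mul]
  exact mul_le_mul_of_nonneg_left (norm_exp_mul_le _ _) (norm_nonneg _)

/-- Dominated differentiation under the integral. All exponential moments of `‖X‖` against `‖F‖` are
finite, so the integral is entire; this makes analytic continuation in the translation parameter
available. -/
theorem differentiable_integral_mul_exp {F X : Ω → ℂ} (hF : AEStronglyMeasurable F μ)
    (hX : AEStronglyMeasurable X μ)
    (h : ∀ R : ℝ, Integrable (fun x ↦ ‖F x‖ * Real.exp (R * ‖X x‖)) μ) :
    Differentiable ℂ fun t : ℂ ↦ ∫ x, F x * Complex.exp (t * X x) ∂μ := by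
  intro t
  have hm : ∀ t : ℂ, AEStronglyMeasurable (fun x ↦ F x * Complex.exp (t * X x)) μ := fun t ↦
    hF.mul (Complex.continuous_exp.comp_aestronglyMeasurable (hX.const_mul t))
  refine (hasDerivAt_integral_of_dominated_loc_of_deriv_le (Metric.ball_mem_nhds t one_pos)
    (F' := fun t x ↦ F x * (Complex.exp (t * X x) * X x))
    -- On the unit ball about `t` the exponent grows by at most one; the second unit absorbs the
    -- factor `X` through `y ≤ exp y`.
    (bound := fun x ↦ ‖F x‖ * Real.exp ((‖t‖ + 2) * ‖X x‖)) (Eventually.of_forall hm)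
    (integrable_mul_exp hF hX h t)
    (hF.mul ((Complex.continuous_exp.comp_aestronglyMeasurable (hX.const_mul t)).mul hX))
    (Eventually.of_forall fun x s hs ↦ ?_) (h _)
    (Eventually.of_forall fun x s _ ↦ ?_)).2.differentiableAt
  · rw [norm_mul, norm_mul]
    refine mul_le_mul_of_nonneg_left ?_ (norm_nonneg _)
    have hs' : ‖s‖ ≤ ‖t‖ + 1 := by
      have := norm_le_norm_add_norm_sub' s t
      rw [Metric.mem_ball, dist_eq_norm] at hs
      linarith
    calc ‖Complex.exp (s * X x)‖ * ‖X x‖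
        ≤ Real.exp ((‖t‖ + 1) * ‖X x‖) * Real.exp ‖X x‖ := by
          refine mul_le_mul ((norm_exp_mul_le _ _).trans (Real.exp_le_exp.2 ?_)) ?_
            (norm_nonneg _) (Real.exp_pos _).le
          · exact mul_le_mul_of_nonneg_right hs' (norm_nonneg _)
          · linarith [Real.add_one_le_exp ‖X x‖]
      _ = _ := by rw [← Real.exp_add]; ring_nf
  · have := ((hasDerivAt_mul_const (X x) (x := s)).cexp).const_mul (F x)
    simpa using this

theorem Differentiable.eq_of_eq_ofReal {f g : ℂ → ℂ} (hf : Differentiable ℂ f)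
    (hg : Differentiable ℂ g) (h : ∀ t : ℝ, f t = g t) : f = g := by
  refine AnalyticOnNhd.eq_of_frequently_eq (z₀ := 0)
    (fun z _ ↦ hf.analyticAt z) (fun z _ ↦ hg.analyticAt z) ?_
  have h1 : Tendsto (fun t : ℝ ↦ (t : ℂ)) (𝓝[≠] 0) (𝓝[≠] 0) := by
    refine tendsto_nhdsWithin_iff.2 ⟨?_, ?_⟩
    · exact (Complex.continuous_ofReal.tendsto' 0 0 (by simp)).mono_left nhdsWithin_le_nhds
    · filter_upwards [self_mem_nhdsWithin] with t ht
      simpa using ht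
  exact h1.frequently (Frequently.of_forall h)

end ExponentialIntegrals

/-! ## Translations of the Gaussian measure -/

namespace HatSpace

section Translation

variable {H : Type u} [NormedAddCommGroup H] [InnerProductSpace ℝ H]

/-- Translation of `Ĥ` by a vector of `H`. -/
def translate (h : H) (x : HatSpace H) : HatSpace H :=
  (show Module.Dual ℝ (StrongDual ℝ H) from x) +
    { toFun := fun l ↦ l h
      map_add' := fun _ _ ↦ rfl
      map_smul' := fun _ _ ↦ rfl }

theorem eval_translate (l : StrongDual ℝ H) (h : H) (x : HatSpace H) :
    eval l (translate h x) = eval l x + l h := rfl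

theorem eval_add (l l' : StrongDual ℝ H) (x : HatSpace H) :
    eval (l + l') x = eval l x + eval l' x :=
  map_add (show Module.Dual ℝ (StrongDual ℝ H) from x) l l'

theorem eval_smul (c : ℝ) (l : StrongDual ℝ H) (x : HatSpace H) :
    eval (c • l) x = c * eval l x :=
  map_smul (show Module.Dual ℝ (StrongDual ℝ H) from x) c l

theorem eval_sum {ι : Type*} (s : Finset ι) (l : ι → StrongDual ℝ H) (x : HatSpace H) :
    eval (∑ i ∈ s, l i) x = ∑ i ∈ s, eval (l i) x :=
  map_sum (show Module.Dual ℝ (StrongDual ℝ H) from x) l s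

theorem measurable_translate (h : H) : Measurable (translate h) :=
  measurable_of_eval fun l ↦ by
    simp only [eval_translate]
    exact (measurable_eval l).add_const _

theorem translate_neg_translate (h : H) (x : HatSpace H) : translate (-h) (translate h x) = x := by
  refine LinearMap.ext fun l ↦ ?_
  change eval l (translate (-h) (translate h x)) = eval l x
  simp [eval_translate]

/-- A finite measure on `Ĥ` is determined by the characteristic functions of the evaluations. -/
theorem measure_ext_of_charFun {μ μ' : Measure (HatSpace H)} [IsFiniteMeasure μ]
    [IsFiniteMeasure μ']
    (h : ∀ l : StrongDual ℝ H, ∫ x, Complex.exp (eval l x * Complex.I) ∂μ =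
      ∫ x, Complex.exp (eval l x * Complex.I) ∂μ') : μ = μ' := by
  classical
  -- `j` embeds `Ĥ` in a product of lines, where a finite measure is determined by its finite
  -- dimensional marginals.
  let j : HatSpace H → (StrongDual ℝ H → ℝ) := fun x l ↦ eval l x
  have hj : Measurable j := measurable_pi_lambda _ fun l ↦ measurable_eval l
  have hproj : ∀ I : Finset (StrongDual ℝ H), (μ.map j).map I.restrict = (μ'.map j).map I.restrict := by
    intro I
    have hI : Measurable (fun f : StrongDual ℝ H → ℝ ↦ I.restrict f) :=
      measurable_pi_lambda _ fun i ↦ measurable_pi_apply _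
    refine Measure.ext_of_charFunDual (funext fun L ↦ ?_)
    have hL : ∀ f : I → ℝ, L f = ∑ i, f i * L (Pi.single i 1) := fun f ↦ by
      conv_lhs => rw [← Finset.univ_sum_single f, map_sum]
      refine Finset.sum_congr rfl fun i _ ↦ ?_
      rw [← smul_eq_mul, ← map_smul, ← Pi.single_smul, smul_eq_mul, mul_one]
    -- A linear combination of evaluations is again an evaluation, so the hypothesis gives the whole
    -- characteristic function of each marginal.
    have key : ∀ x, L (I.restrict (j x)) = eval (∑ i : I, L (Pi.single i 1) • (i : StrongDual ℝ H)) x := by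
      intro x
      rw [hL, eval_sum]
      refine Finset.sum_congr rfl fun i _ ↦ ?_
      rw [eval_smul, mul_comm]; rfl
    have hm : ∀ m : Measure (HatSpace H), charFunDual ((m.map j).map I.restrict) L =
        ∫ x, Complex.exp (eval (∑ i : I, L (Pi.single i 1) • (i : StrongDual ℝ H)) x * Complex.I) ∂m := by
      intro m
      rw [charFunDual_apply, Measure.map_map hI hj, integral_map (hI.comp hj).aemeasurable
        (by fun_prop)]
      simp only [Function.comp_apply, key]
    rw [hm, hm, h]
  have hmap : μ.map j = μ'.map j :=
    IsProjectiveLimit.unique (P := fun I ↦ (μ'.map j).map I.restrict)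
      (fun I ↦ hproj I) (fun _ ↦ rfl)
  have hσ : (inferInstance : MeasurableSpace (HatSpace H)) ≤ MeasurableSpace.comap j inferInstance := by
    refine iSup_le fun l ↦ ?_
    have : eval l = (fun f : StrongDual ℝ H → ℝ ↦ f l) ∘ j := rfl
    rw [this, ← MeasurableSpace.comap_comp]
    exact MeasurableSpace.comap_mono (measurable_pi_apply l).comap_le
  refine Measure.ext fun s hs ↦ ?_
  obtain ⟨B, hB, rfl⟩ := hσ s hs
  rw [← Measure.map_apply hj hB, hmap, Measure.map_apply hj hB]

variable [CompleteSpace H]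

theorem integral_comp_eval {E : Type*} [NormedAddCommGroup E] [NormedSpace ℝ E]
    (l : StrongDual ℝ H) {f : ℝ → E} (hf : Continuous f) :
    ∫ x, f (eval l x) ∂(gaussian H) = ∫ y, f y ∂(gaussianReal 0 (‖l‖₊ ^ 2)) := by
  rw [← map_eval_gaussian l, integral_map (measurable_eval l).aemeasurable]
  rw [map_eval_gaussian]
  exact hf.aestronglyMeasurable

theorem charFun_gaussian (l : StrongDual ℝ H) :
    ∫ x, Complex.exp (eval l x * Complex.I) ∂(gaussian H) =
      Complex.exp (-(‖l‖ ^ 2 / 2 : ℝ)) := by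
  rw [integral_comp_eval l (f := fun y : ℝ ↦ Complex.exp (y * Complex.I)) (by fun_prop)]
  have := charFun_gaussianReal (μ := 0) (v := ‖l‖₊ ^ 2) 1
  rw [charFun_apply_real] at this
  simpa using this

theorem integrable_exp_mul_abs_eval (l : StrongDual ℝ H) (R : ℝ) :
    Integrable (fun x ↦ Real.exp (R * |eval l x|)) (gaussian H) := by
  have h1 : ∀ c : ℝ, Integrable (fun x ↦ Real.exp (c * eval l x)) (gaussian H) := fun c ↦ by
    have := integrable_exp_mul_gaussianReal (μ := 0) (v := ‖l‖₊ ^ 2) c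
    rw [← map_eval_gaussian l] at this
    exact this.comp_measurable (measurable_eval l)
  refine ((h1 R).add (h1 (-R))).mono' ?_ (Eventually.of_forall fun x ↦ ?_)
  · exact (Real.measurable_exp.comp
      ((measurable_eval l).abs.const_mul R)).aestronglyMeasurable
  · rw [Real.norm_of_nonneg (Real.exp_pos _).le, Pi.add_apply]
    rcases abs_cases (eval l x) with ⟨h, -⟩ | ⟨h, -⟩ <;> rw [h]
    · linarith [Real.exp_pos (-R * eval l x)]
    · rw [mul_neg, ← neg_mul]; linarith [Real.exp_pos (R * eval l x)]

/-- For the purely imaginary exponent `t i ⟨h, ·⟩` with `t` real, this is the characteristic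
function at `l + t h`. Both sides are entire in `t`, and `t = -i` gives the real exponential. -/
theorem integral_exp_eval_mul_I_add (l : StrongDual ℝ H) (h : H) :
    ∫ x, Complex.exp (eval l x * Complex.I) * Complex.exp (eval (innerSL ℝ h) x) ∂(gaussian H) =
      Complex.exp (-(‖l‖ ^ 2 / 2 : ℝ) + l h * Complex.I + (‖h‖ ^ 2 / 2 : ℝ)) := by
  have hm : ∀ l : StrongDual ℝ H, Measurable fun x ↦ (eval l x : ℂ) :=
    fun l ↦ Complex.measurable_ofReal.comp (measurable_eval l)
  have hd := differentiable_integral_mul_exp (μ := gaussian H)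
    (F := fun x ↦ Complex.exp (eval l x * Complex.I))
    (X := fun x ↦ Complex.I * eval (innerSL ℝ h) x)
    (Complex.measurable_exp.comp ((hm l).mul_const _)).aestronglyMeasurable
    ((hm _).const_mul _).aestronglyMeasurable fun R ↦ by
      simpa [Complex.norm_exp] using integrable_exp_mul_abs_eval (innerSL ℝ h) R
  have hl : l h = inner ℝ ((InnerProductSpace.toDual ℝ H).symm l) h := by simp
  have key := Differentiable.eq_of_eq_ofReal hd (g := fun t : ℂ ↦
    Complex.exp (-(‖l‖ ^ 2 / 2 : ℝ) - t * l h - t ^ 2 * (‖h‖ ^ 2 / 2 : ℝ))) (by fun_prop) fun t ↦ by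
      have h1 := charFun_gaussian (l + t • innerSL ℝ h)
      have h2 : ‖l + t • innerSL ℝ h‖ ^ 2 = ‖l‖ ^ 2 + 2 * (t * l h) + t ^ 2 * ‖h‖ ^ 2 := by
        have e : l + t • innerSL ℝ h =
            InnerProductSpace.toDual ℝ H ((InnerProductSpace.toDual ℝ H).symm l + t • h) := by
          ext y; simp
        rw [e, LinearIsometryEquiv.norm_map, norm_add_sq_real, LinearIsometryEquiv.norm_map,
          inner_smul_right, hl, norm_smul, mul_pow, Real.norm_eq_abs, sq_abs]
      rw [h2] at h1
      convert h1 using 3 with x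
      · rw [← Complex.exp_add, eval_add, eval_smul]; push_cast; ring_nf
      · push_cast; ring
  have := congrFun key (-Complex.I)
  convert this using 3 with x
  · congr 1; ring_nf; simp
  · ring_nf; simp

/-- The Cameron-Martin formula. -/
theorem map_translate_gaussian (h : H) :
    (gaussian H).map (translate h) = (gaussian H).withDensity
      fun x ↦ ENNReal.ofReal (Real.exp (eval (innerSL ℝ h) x - ‖h‖ ^ 2 / 2)) := by
  have hmd : Measurable fun x : HatSpace H ↦ Real.exp (eval (innerSL ℝ h) x - ‖h‖ ^ 2 / 2) :=
    Real.measurable_exp.comp ((measurable_eval _).sub_const _)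
  have hi : Integrable (fun x ↦ Real.exp (eval (innerSL ℝ h) x - ‖h‖ ^ 2 / 2)) (gaussian H) := by
    refine ((integrable_exp_mul_abs_eval (innerSL ℝ h) 1)).mono' hmd.aestronglyMeasurable
      (Eventually.of_forall fun x ↦ ?_)
    rw [Real.norm_of_nonneg (Real.exp_pos _).le]
    refine Real.exp_le_exp.2 ?_
    have := le_abs_self (eval (innerSL ℝ h) x)
    have := sq_nonneg ‖h‖
    linarith
  have : IsProbabilityMeasure ((gaussian H).map (translate h)) :=
    Measure.isProbabilityMeasure_map (measurable_translate h).aemeasurable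
  have := isFiniteMeasure_withDensity_ofReal hi.2
  refine measure_ext_of_charFun fun l ↦ ?_
  have hm : Measurable fun x : HatSpace H ↦ Complex.exp (eval l x * Complex.I) :=
    Complex.measurable_exp.comp ((Complex.measurable_ofReal.comp (measurable_eval l)).mul_const _)
  rw [integral_map (measurable_translate h).aemeasurable hm.aestronglyMeasurable,
    integral_withDensity_eq_integral_toReal_smul hmd.ennreal_ofReal
      (Eventually.of_forall fun _ ↦ ENNReal.ofReal_lt_top)]
  simp only [ENNReal.toReal_ofReal (Real.exp_pos _).le, eval_translate, Complex.real_smul]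
  have e1 : ∀ x : HatSpace H, Complex.exp ((eval l x + l h : ℝ) * Complex.I) =
      Complex.exp (l h * Complex.I) * Complex.exp (eval l x * Complex.I) := fun x ↦ by
    rw [← Complex.exp_add]; push_cast; ring_nf
  have e2 : ∀ x : HatSpace H, ((Real.exp (eval (innerSL ℝ h) x - ‖h‖ ^ 2 / 2) : ℝ) : ℂ) *
      Complex.exp (eval l x * Complex.I) = Complex.exp (-(‖h‖ ^ 2 / 2 : ℝ)) *
        (Complex.exp (eval l x * Complex.I) * Complex.exp (eval (innerSL ℝ h) x)) := fun x ↦ by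
    rw [Complex.ofReal_exp, ← Complex.exp_add, ← Complex.exp_add, ← Complex.exp_add]
    push_cast; ring_nf
  simp only [e1, e2]
  rw [integral_const_mul, integral_const_mul, charFun_gaussian, integral_exp_eval_mul_I_add,
    ← Complex.exp_add, ← Complex.exp_add]
  ring_nf

theorem integral_translate {E : Type*} [NormedAddCommGroup E] [NormedSpace ℝ E] (h : H)
    {f : HatSpace H → E} (hf : StronglyMeasurable f) :
    ∫ x, f (translate h x) ∂(gaussian H) =
      ∫ x, Real.exp (eval (innerSL ℝ h) x - ‖h‖ ^ 2 / 2) • f x ∂(gaussian H) := by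
  have hmd : Measurable fun x : HatSpace H ↦ Real.exp (eval (innerSL ℝ h) x - ‖h‖ ^ 2 / 2) :=
    Real.measurable_exp.comp ((measurable_eval _).sub_const _)
  rw [← integral_map (measurable_translate h).aemeasurable hf.aestronglyMeasurable,
    map_translate_gaussian, integral_withDensity_eq_integral_toReal_smul hmd.ennreal_ofReal
      (Eventually.of_forall fun _ ↦ ENNReal.ofReal_lt_top)]
  simp only [ENNReal.toReal_ofReal (Real.exp_pos _).le]

theorem integrable_translate_iff {E : Type*} [NormedAddCommGroup E] [NormedSpace ℝ E] (h : H)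
    {f : HatSpace H → E} (hf : StronglyMeasurable f) :
    Integrable (fun x ↦ f (translate h x)) (gaussian H) ↔
      Integrable (fun x ↦ Real.exp (eval (innerSL ℝ h) x - ‖h‖ ^ 2 / 2) • f x) (gaussian H) := by
  have hmd : Measurable fun x : HatSpace H ↦ Real.exp (eval (innerSL ℝ h) x - ‖h‖ ^ 2 / 2) :=
    Real.measurable_exp.comp ((measurable_eval _).sub_const _)
  have := integrable_map_measure (f := translate h) (μ := gaussian H) (g := f)
    hf.aestronglyMeasurable (measurable_translate h).aemeasurable
  rw [show (fun x ↦ f (translate h x)) = f ∘ translate h from rfl, ← this,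
    map_translate_gaussian, integrable_withDensity_iff_integrable_smul' hmd.ennreal_ofReal
      (Eventually.of_forall fun _ ↦ ENNReal.ofReal_lt_top)]
  simp only [ENNReal.toReal_ofReal (Real.exp_pos _).le]

end Translation

end HatSpace

/-! ## Cylinder functions and Gaussian functions of quadratic forms -/

namespace HatSpace

section Cylinder

variable {H : Type u} [NormedAddCommGroup H] [InnerProductSpace ℝ H]

theorem proj_mem (N : FinSub H) (x : HatSpace H) : proj N x ∈ N.1 :=
  Submodule.sum_mem _ fun _ _ ↦ N.1.smul_mem _ (Subtype.property _)

theorem sum_inner_smul_stdOrthonormalBasis (N : FinSub H) {h : H} (hh : h ∈ N.1) :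
    haveI := N.2
    ∑ i, inner ℝ (stdOrthonormalBasis ℝ N.1 i : H) h • (stdOrthonormalBasis ℝ N.1 i : H) = h := by
  have := N.2
  have h1 := congrArg (Subtype.val) ((stdOrthonormalBasis ℝ N.1).sum_repr' ⟨h, hh⟩)
  simpa using h1

/-- Projection and translation are compatible only when `N` contains the vector; the estimates below
are therefore made for `N` large enough. -/
theorem proj_translate (N : FinSub H) {h : H} (hh : h ∈ N.1) (x : HatSpace H) :
    proj N (translate h x) = proj N x + h := by
  have := N.2
  conv_rhs => rw [← sum_inner_smul_stdOrthonormalBasis N hh]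
  simp only [proj, eval_translate, add_smul, Finset.sum_add_distrib]
  rfl

theorem inner_proj (N : FinSub H) {h : H} (hh : h ∈ N.1) (x : HatSpace H) :
    inner ℝ h (proj N x) = eval (innerSL ℝ h) x := by
  have := N.2
  conv_rhs => rw [← sum_inner_smul_stdOrthonormalBasis N hh]
  simp only [proj, inner_sum, inner_smul_right, map_sum, map_smul, eval_sum, eval_smul]
  refine Finset.sum_congr rfl fun i _ ↦ ?_
  rw [real_inner_comm, mul_comm]

/-- Continuity of `L` is not needed: on the finite dimensional `N` only its values on a basis enter.
-/
theorem measurable_map_proj {E : Type*} [NormedAddCommGroup E] [NormedSpace ℝ E]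
    [MeasurableSpace E] [BorelSpace E] [SecondCountableTopology E]
    (L : H →ₗ[ℝ] E) (N : FinSub H) : Measurable fun x ↦ L (proj N x) := by
  have := N.2
  simp only [proj, map_sum, map_smul]
  exact Finset.measurable_sum _ fun i _ ↦ (measurable_eval _).smul_const _

theorem measurable_bilin_proj {E : Type*} [NormedAddCommGroup E] [NormedSpace ℝ E]
    [MeasurableSpace E] [BorelSpace E] [SecondCountableTopology E]
    (B : H →ₗ[ℝ] H →ₗ[ℝ] E) (N : FinSub H) : Measurable fun x ↦ B (proj N x) (proj N x) := by
  have := N.2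
  have : ∀ x, B (proj N x) (proj N x) = ∑ i, eval (innerSL ℝ (stdOrthonormalBasis ℝ N.1 i : H)) x •
      B (stdOrthonormalBasis ℝ N.1 i : H) (proj N x) := fun x ↦ by
    conv_lhs => enter [1, 2]; unfold proj
    simp
  simp only [this]
  exact Finset.measurable_sum _ fun i _ ↦ (measurable_eval _).smul (measurable_map_proj _ N)

/-- The action of translation by `h` on densities with respect to the Gaussian measure. -/
noncomputable def shift (h : H) (f : H → ℂ) (ξ : H) : ℂ :=
  Real.exp (inner ℝ h ξ - ‖h‖ ^ 2 / 2) * f (ξ - h)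

theorem proj_translate_neg (N : FinSub H) {h : H} (hh : h ∈ N.1) (x : HatSpace H) :
    proj N (translate (-h) x) = proj N x - h := by
  rw [proj_translate N (N.1.neg_mem hh), sub_eq_add_neg]

theorem shift_proj (N : FinSub H) {h : H} (hh : h ∈ N.1) (f : H → ℂ) (x : HatSpace H) :
    shift h f (proj N x) =
      Real.exp (eval (innerSL ℝ h) x - ‖h‖ ^ 2 / 2) * f (proj N (translate (-h) x)) := by
  rw [shift, proj_translate_neg N hh, inner_proj N hh]

variable [CompleteSpace H]

/-- Cameron-Martin applied to `f` precomposed with the inverse translation: the density exactly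
compensates the translation. -/
theorem integral_eq_integral_translate_neg {E : Type*} [NormedAddCommGroup E] [NormedSpace ℝ E]
    (h : H) {f : HatSpace H → E} (hf : StronglyMeasurable f) :
    ∫ x, Real.exp (eval (innerSL ℝ h) x - ‖h‖ ^ 2 / 2) • f (translate (-h) x) ∂(gaussian H) =
      ∫ x, f x ∂(gaussian H) := by
  rw [← integral_translate h (f := fun x ↦ f (translate (-h) x))
    (hf.comp_measurable (measurable_translate _))]
  simp only [translate_neg_translate]

theorem integrable_translate_neg {E : Type*} [NormedAddCommGroup E] [NormedSpace ℝ E]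
    (h : H) {f : HatSpace H → E} (hf : StronglyMeasurable f) (hi : Integrable f (gaussian H)) :
    Integrable (fun x ↦ Real.exp (eval (innerSL ℝ h) x - ‖h‖ ^ 2 / 2) • f (translate (-h) x))
      (gaussian H) := by
  rw [← integrable_translate_iff h (f := fun x ↦ f (translate (-h) x))
    (hf.comp_measurable (measurable_translate _))]
  simpa only [translate_neg_translate] using hi

theorem integrable_shift (N : FinSub H) {h : H} (hh : h ∈ N.1) {f : H → ℂ}
    (hf : Measurable fun x ↦ f (proj N x)) (hi : Integrable (fun x ↦ f (proj N x)) (gaussian H)) :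
    Integrable (fun x ↦ shift h f (proj N x)) (gaussian H) := by
  simpa only [shift_proj N hh, Complex.real_smul] using
    integrable_translate_neg h hf.stronglyMeasurable hi

theorem integral_shift (N : FinSub H) {h : H} (hh : h ∈ N.1) {f : H → ℂ}
    (hf : Measurable fun x ↦ f (proj N x)) :
    ∫ x, shift h f (proj N x) ∂(gaussian H) = ∫ x, f (proj N x) ∂(gaussian H) := by
  simpa only [shift_proj N hh, Complex.real_smul] using
    integral_eq_integral_translate_neg h hf.stronglyMeasurable

/-- Real translations are L¹ isometries, including on differences of cylinder functions over
different subspaces. Hence Cauchy estimates pass to translates without loss. -/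
theorem integral_norm_shift_sub_shift (N N' : FinSub H) {h : H} (hh : h ∈ N.1) (hh' : h ∈ N'.1)
    {f : H → ℂ} (hf : Measurable fun x ↦ f (proj N x)) (hf' : Measurable fun x ↦ f (proj N' x)) :
    ∫ x, ‖shift h f (proj N x) - shift h f (proj N' x)‖ ∂(gaussian H) =
      ∫ x, ‖f (proj N x) - f (proj N' x)‖ ∂(gaussian H) := by
  rw [← integral_eq_integral_translate_neg h
    (f := fun x ↦ ‖f (proj N x) - f (proj N' x)‖) (hf.sub hf').norm.stronglyMeasurable]
  refine integral_congr_ae (Eventually.of_forall fun x ↦ ?_)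
  simp only [shift_proj N hh, shift_proj N' hh', ← mul_sub, norm_mul, Complex.norm_real,
    Real.norm_of_nonneg (Real.exp_pos _).le, smul_eq_mul]

end Cylinder

/-! ### Finite dimensional Gaussian integrals and their exponential moments -/

section GaussFn

variable {H : Type u} [NormedAddCommGroup H] [InnerProductSpace ℝ H]

/-- The Gaussian function of a complex quadratic form on `H`, as a density with respect to the
Gaussian measure. -/
noncomputable def gaussFn (B : H →ₗ[ℝ] H →ₗ[ℝ] ℂ) (ξ : H) : ℂ :=
  Complex.exp (-(B ξ ξ) / 2 + (inner ℝ ξ ξ : ℝ) / 2)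

/-- The real part of a complex valued bilinear form. -/
noncomputable def reForm (B : H →ₗ[ℝ] H →ₗ[ℝ] ℂ) : H →ₗ[ℝ] H →ₗ[ℝ] ℂ :=
  B.compr₂ (Complex.ofRealCLM.toLinearMap ∘ₗ Complex.reLm)

theorem reForm_apply (B : H →ₗ[ℝ] H →ₗ[ℝ] ℂ) (x y : H) : reForm B x y = ((B x y).re : ℂ) := rfl

/-- The modulus is again a Gaussian function, so results for complex forms also apply to L¹ norms.
-/
theorem norm_gaussFn (B : H →ₗ[ℝ] H →ₗ[ℝ] ℂ) (ξ : H) :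
    ((‖gaussFn B ξ‖ : ℝ) : ℂ) = gaussFn (reForm B) ξ := by
  rw [gaussFn, gaussFn, Complex.norm_exp, Complex.ofReal_exp, reForm_apply]
  congr 1
  rw [← Complex.ofReal_ofNat, ← Complex.ofReal_div, Complex.add_re, Complex.ofReal_re,
    Complex.div_ofReal_re, Complex.neg_re]
  push_cast
  rfl

theorem norm_gaussFn_pos (B : H →ₗ[ℝ] H →ₗ[ℝ] ℂ) (ξ : H) : 0 < ‖gaussFn B ξ‖ :=
  norm_pos_iff.2 (Complex.exp_ne_zero _)

/-- The weight `exp(½⟨ξ,ξ⟩)` cancels the Cameron-Martin density. What remains is the ordinary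
translation of `exp(-B/2)`, expanded as a linear exponential. -/
theorem shift_gaussFn {B : H →ₗ[ℝ] H →ₗ[ℝ] ℂ} (hB : ∀ x y, B x y = B y x) (h ξ : H) :
    shift h (gaussFn B) ξ = gaussFn B ξ * Complex.exp (B ξ h - B h h / 2) := by
  rw [shift, gaussFn, gaussFn, Complex.ofReal_exp, ← Complex.exp_add, ← Complex.exp_add]
  congr 1
  simp only [map_sub, LinearMap.sub_apply, inner_sub_left, inner_sub_right,
    real_inner_self_eq_norm_sq, hB h ξ, real_inner_comm h ξ]
  push_cast
  ring

theorem norm_gaussFn_mul_exp (hB : ∀ x y, B x y = B y x) (h ξ : H) :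
    ‖gaussFn B ξ‖ * Real.exp (B ξ h).re =
      Real.exp ((B h h).re / 2) * ‖shift h (gaussFn B) ξ‖ := by
  rw [shift_gaussFn hB, norm_mul, Complex.norm_exp, mul_left_comm, ← Real.exp_add]
  simp

theorem measurable_gaussFn_proj (B : H →ₗ[ℝ] H →ₗ[ℝ] ℂ) (N : FinSub H) :
    Measurable fun x ↦ gaussFn B (proj N x) := by
  refine Complex.measurable_exp.comp (((measurable_bilin_proj B N).neg.div_const _).add
    ((Complex.measurable_ofReal.comp ?_).div_const _))
  exact measurable_bilin_proj (innerₗ H) N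

variable [CompleteSpace H] {B : H →ₗ[ℝ] H →ₗ[ℝ] ℂ} {N : FinSub H}

theorem integrable_gaussFn_reForm
    (hi : Integrable (fun x ↦ gaussFn B (proj N x)) (gaussian H)) :
    Integrable (fun x ↦ gaussFn (reForm B) (proj N x)) (gaussian H) := by
  exact (hi.norm.ofReal (𝕜 := ℂ)).congr (Eventually.of_forall fun x ↦ norm_gaussFn B _)

/-- Integrability of a Gaussian function makes the real part of the form positive. -/
theorem re_pos_of_integrable_gaussFn (hB : ∀ x y, B x y = B y x)
    (hi : Integrable (fun x ↦ gaussFn B (proj N x)) (gaussian H)) {e : H} (he : e ∈ N.1)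
    (he0 : e ≠ 0) : 0 < (B e e).re := by
  -- If the real part were nonpositive on `e`, the mass of `‖gaussFn B‖` would not decay along `e`.
  -- Here `J t` measures the mass near the slice `⟨e, x⟩ = -t c`, localized by a Gaussian cutoff.
  by_contra! hκ
  set κ := (B e e).re
  have hc : 0 < ‖e‖ ^ 2 := by positivity
  set c := ‖e‖ ^ 2
  have hG := (measurable_gaussFn_proj B N).norm
  have hev := measurable_eval (innerSL ℝ e)
  let J : ℝ → ℝ := fun t ↦ ∫ x, ‖gaussFn B (proj N x)‖ *
    Real.exp (-(eval (innerSL ℝ e) x + t * c) ^ 2) ∂(gaussian H)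
  have hmeas : ∀ t : ℝ, Measurable fun x ↦ ‖gaussFn B (proj N x)‖ *
    Real.exp (-(eval (innerSL ℝ e) x + t * c) ^ 2) := fun t ↦
      hG.mul (Real.measurable_exp.comp ((hev.add_const _).pow_const 2).neg)
  have hle : ∀ (t : ℝ) (x : HatSpace H), ‖‖gaussFn B (proj N x)‖ *
      Real.exp (-(eval (innerSL ℝ e) x + t * c) ^ 2)‖ ≤ ‖gaussFn B (proj N x)‖ := fun t x ↦ by
    rw [norm_mul, norm_norm, Real.norm_of_nonneg (Real.exp_pos _).le]
    refine mul_le_of_le_one_right (norm_nonneg _) (Real.exp_le_one_iff.2 ?_)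
    have := sq_nonneg (eval (innerSL ℝ e) x + t * c)
    linarith
  have hint : ∀ t : ℝ, Integrable (fun x ↦ ‖gaussFn B (proj N x)‖ *
      Real.exp (-(eval (innerSL ℝ e) x + t * c) ^ 2)) (gaussian H) := fun t ↦
    hi.norm.mono' (hmeas t).aestronglyMeasurable (Eventually.of_forall (hle t))
  have hsh : ∀ (t : ℝ) (x : HatSpace H), Real.exp (eval (innerSL ℝ (t • e)) x - ‖t • e‖ ^ 2 / 2) •
      (‖gaussFn B (proj N (translate (-(t • e)) x))‖ *
        Real.exp (-(eval (innerSL ℝ e) (translate (-(t • e)) x) + t * c) ^ 2)) =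
      Real.exp (t * (B (proj N x) e).re - t ^ 2 * κ / 2) * (‖gaussFn B (proj N x)‖ *
        Real.exp (-(eval (innerSL ℝ e) x + 0 * c) ^ 2)) := fun t x ↦ by
    have h1 := congrArg norm ((shift_proj N (N.1.smul_mem t he) (gaussFn B) x).symm.trans
      (shift_gaussFn hB (t • e) (proj N x)))
    rw [norm_mul, norm_mul, Complex.norm_real, Real.norm_of_nonneg (Real.exp_pos _).le,
      Complex.norm_exp] at h1
    rw [smul_eq_mul, ← mul_assoc, h1, eval_translate]
    have h2 : (innerSL ℝ e) (-(t • e)) = - (t * c) := by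
      simp [inner_smul_right, c]
    have h3 : (B (proj N x) (t • e) - B (t • e) (t • e) / 2).re =
        t * (B (proj N x) e).re - t ^ 2 * κ / 2 := by
      simp [κ]; ring
    rw [h2, h3]
    ring_nf
  have hJ : ∀ t, J t = ∫ x, Real.exp (t * (B (proj N x) e).re - t ^ 2 * κ / 2) *
      (‖gaussFn B (proj N x)‖ * Real.exp (-(eval (innerSL ℝ e) x + 0 * c) ^ 2)) ∂(gaussian H) :=
    fun t ↦ by
      change ∫ x, _ ∂(gaussian H) = _
      rw [← integral_eq_integral_translate_neg (t • e) (hmeas t).stronglyMeasurable]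
      exact integral_congr_ae (Eventually.of_forall (hsh t))
  have hJi : ∀ t, Integrable (fun x ↦ Real.exp (t * (B (proj N x) e).re - t ^ 2 * κ / 2) *
      (‖gaussFn B (proj N x)‖ * Real.exp (-(eval (innerSL ℝ e) x + 0 * c) ^ 2))) (gaussian H) :=
    fun t ↦ (integrable_translate_neg (t • e) (hmeas t).stronglyMeasurable (hint t)).congr
      (Eventually.of_forall (hsh t))
  -- After translation to the slice at the origin, the linear exponents for `t` and `-t` cancel to
  -- first order by `exp u ≥ 1 + u`, and `-t² κ ≥ 0`.
  have hge : ∀ t, 2 * J 0 ≤ J t + J (-t) := fun t ↦ by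
    rw [hJ t, hJ (-t), ← integral_add (hJi t) (hJi (-t)), ← integral_const_mul]
    refine integral_mono ((hint 0).const_mul 2) ((hJi t).add (hJi (-t))) fun x ↦ ?_
    rw [← add_mul]
    refine mul_le_mul_of_nonneg_right ?_ (by positivity)
    have ha := Real.add_one_le_exp (t * (B (proj N x) e).re - t ^ 2 * κ / 2)
    have hb := Real.add_one_le_exp (-t * (B (proj N x) e).re - (-t) ^ 2 * κ / 2)
    nlinarith [mul_nonneg (sq_nonneg t) (neg_nonneg.2 hκ)]
  -- Dominated convergence: the cutoff moves off to infinity while the total mass is finite. This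
  -- contradicts `hge`, since `J 0 > 0`.
  have hlim : ∀ s : ℝ, s ≠ 0 → Tendsto (fun t : ℝ ↦ J (s * t)) atTop (𝓝 0) := fun s hs ↦ by
    rw [← integral_zero (HatSpace H) ℝ (μ := gaussian H)]
    refine tendsto_integral_filter_of_dominated_convergence _
      (Eventually.of_forall fun t ↦ (hmeas _).aestronglyMeasurable)
      (Eventually.of_forall fun t ↦ Eventually.of_forall (hle _)) hi.norm
      (Eventually.of_forall fun x ↦ ?_)
    rw [← mul_zero ‖gaussFn B (proj N x)‖]
    refine Tendsto.const_mul _ (Real.tendsto_exp_neg_atTop_nhds_zero.comp ?_)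
    have h1 : Tendsto (fun t : ℝ ↦ |s * t * c|) atTop atTop := by
      simp only [abs_mul, abs_of_pos hc]
      exact (tendsto_abs_atTop_atTop.const_mul_atTop (abs_pos.2 hs)).atTop_mul_const hc
    have h2 : Tendsto (fun t : ℝ ↦ |eval (innerSL ℝ e) x + s * t * c|) atTop atTop := by
      refine tendsto_atTop_mono (fun t ↦ ?_) (tendsto_atTop_add_const_right _ (-|eval (innerSL ℝ e) x|) h1)
      have := abs_add_le (eval (innerSL ℝ e) x + s * t * c) (-eval (innerSL ℝ e) x)
      rw [abs_neg] at this
      have h3 : eval (innerSL ℝ e) x + s * t * c + -eval (innerSL ℝ e) x = s * t * c := by ring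
      rw [h3] at this
      linarith
    exact ((tendsto_pow_atTop two_ne_zero).comp h2).congr fun t ↦ by simp
  have h0 : 2 * J 0 ≤ 0 := by
    have := (hlim 1 one_ne_zero).add (hlim (-1) (by norm_num))
    rw [add_zero] at this
    exact ge_of_tendsto' this fun t ↦ by simpa using hge t
  have hpos : 0 < J 0 := by
    refine (integral_pos_iff_support_of_nonneg (fun x ↦ by positivity) (hint 0)).2 ?_
    have : Function.support (fun x ↦ ‖gaussFn B (proj N x)‖ *
        Real.exp (-(eval (innerSL ℝ e) x + 0 * c) ^ 2)) = Set.univ :=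
      Set.eq_univ_of_forall fun x ↦ (mul_pos (norm_gaussFn_pos B _) (Real.exp_pos _)).ne'
    rw [this]
    simp
  linarith

/-- Linear functionals on `N` are represented by the real part of the form. -/
theorem exists_re_eq_of_integrable_gaussFn (hB : ∀ x y, B x y = B y x)
    (hi : Integrable (fun x ↦ gaussFn B (proj N x)) (gaussian H)) (l : H →ₗ[ℝ] ℝ) :
    ∃ h ∈ N.1, ∀ x ∈ N.1, (B x h).re = l x := by
  have := N.2
  let T : N.1 →ₗ[ℝ] Module.Dual ℝ N.1 :=
    (B.compr₂ Complex.reLm).domRestrict₁₂ N.1 N.1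
  have hT : ∀ h x : N.1, T h x = (B h x).re := fun h x ↦ rfl
  -- Positivity of the real part makes it nondegenerate on `N`; equality of dimensions then gives
  -- surjectivity onto the dual.
  have hinj : Function.Injective T := by
    rw [← LinearMap.ker_eq_bot, LinearMap.ker_eq_bot']
    intro h h0
    by_contra hne
    have h1 := re_pos_of_integrable_gaussFn hB hi h.2 (fun h2 ↦ hne (Subtype.ext h2))
    rw [← hT, h0] at h1
    simp at h1
  obtain ⟨h, hh⟩ := (LinearMap.injective_iff_surjective_of_finrank_eq_finrank
    (Subspace.dual_finrank_eq (K := ℝ) (V := N.1)).symm).1 hinj (l ∘ₗ N.1.subtype)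
  refine ⟨h, h.2, fun x hx ↦ ?_⟩
  rw [hB, ← hT h ⟨x, hx⟩, hh]
  rfl

theorem integral_norm_gaussFn_mul_exp (hB : ∀ x y, B x y = B y x) {h : H} (hh : h ∈ N.1) :
    ∫ x, ‖gaussFn B (proj N x)‖ * Real.exp (B (proj N x) h).re ∂(gaussian H) =
      Real.exp ((B h h).re / 2) * ∫ x, ‖gaussFn B (proj N x)‖ ∂(gaussian H) := by
  simp only [norm_gaussFn_mul_exp hB]
  rw [integral_const_mul,
    ← integral_eq_integral_translate_neg h (measurable_gaussFn_proj B N).norm.stronglyMeasurable]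
  simp only [shift_proj N hh, norm_mul, Complex.norm_real,
    Real.norm_of_nonneg (Real.exp_pos _).le, smul_eq_mul]

/-- Representing `l` by the real part of `B` turns the linear exponential into a translation, which
preserves integrability. -/
theorem integrable_norm_gaussFn_mul_exp (hB : ∀ x y, B x y = B y x)
    (hi : Integrable (fun x ↦ gaussFn B (proj N x)) (gaussian H)) (l : H →ₗ[ℝ] ℝ) :
    Integrable (fun x ↦ ‖gaussFn B (proj N x)‖ * Real.exp (l (proj N x))) (gaussian H) := by
  obtain ⟨h, hh, hl⟩ := exists_re_eq_of_integrable_gaussFn hB hi l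
  have : ∀ x, ‖gaussFn B (proj N x)‖ * Real.exp (l (proj N x)) =
      Real.exp ((B h h).re / 2) * ‖shift h (gaussFn B) (proj N x)‖ := fun x ↦ by
    rw [← hl _ (proj_mem N x), norm_gaussFn_mul_exp hB]
  simp only [this]
  exact (integrable_shift N hh (measurable_gaussFn_proj B N) hi).norm.const_mul _

theorem integrable_norm_gaussFn_mul_exp_norm (hB : ∀ x y, B x y = B y x)
    (hi : Integrable (fun x ↦ gaussFn B (proj N x)) (gaussian H)) (L : H →ₗ[ℝ] ℂ) (R : ℝ) :
    Integrable (fun x ↦ ‖gaussFn B (proj N x)‖ * Real.exp (R * ‖L (proj N x)‖)) (gaussian H) := by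
  let l₁ := Complex.reLm ∘ₗ L
  let l₂ := Complex.imLm ∘ₗ L
  have h := fun l ↦ integrable_norm_gaussFn_mul_exp hB hi l
  -- The norm is at most `|Re| + |Im|`; the exponential of this is one of four sign choices, hence
  -- at most their sum.
  refine ((((h (|R| • (l₁ + l₂))).add (h (|R| • (l₁ - l₂)))).add (h (|R| • (-l₁ + l₂)))).add
    (h (|R| • (-l₁ - l₂)))).mono' ?_ (Eventually.of_forall fun x ↦ ?_)
  · exact ((measurable_gaussFn_proj B N).norm.mul (Real.measurable_exp.comp
      ((measurable_map_proj L N).norm.const_mul R))).aestronglyMeasurable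
  · simp only [Pi.add_apply, ← mul_add]
    rw [norm_mul, norm_norm, Real.norm_of_nonneg (Real.exp_pos _).le]
    refine mul_le_mul_of_nonneg_left ?_ (norm_nonneg _)
    have h1 : R * ‖L (proj N x)‖ ≤ |R| * (|l₁ (proj N x)| + |l₂ (proj N x)|) :=
      mul_le_mul (le_abs_self R) (Complex.norm_le_abs_re_add_abs_im _) (norm_nonneg _)
        (abs_nonneg _)
    refine (Real.exp_le_exp.2 h1).trans ?_
    simp only [LinearMap.smul_apply, LinearMap.add_apply, LinearMap.sub_apply, LinearMap.neg_apply,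
      smul_eq_mul]
    have p1 := Real.exp_pos (|R| * (l₁ (proj N x) + l₂ (proj N x)))
    have p2 := Real.exp_pos (|R| * (l₁ (proj N x) - l₂ (proj N x)))
    have p3 := Real.exp_pos (|R| * (-l₁ (proj N x) + l₂ (proj N x)))
    have p4 := Real.exp_pos (|R| * (-l₁ (proj N x) - l₂ (proj N x)))
    rcases abs_cases (l₁ (proj N x)) with ⟨e1, -⟩ | ⟨e1, -⟩ <;>
    rcases abs_cases (l₂ (proj N x)) with ⟨e2, -⟩ | ⟨e2, -⟩ <;> rw [e1, e2] <;>
    simp only [sub_eq_add_neg] at * <;> linarith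

theorem integrable_gaussFn_mul_exp (hB : ∀ x y, B x y = B y x)
    (hi : Integrable (fun x ↦ gaussFn B (proj N x)) (gaussian H)) (L : H →ₗ[ℝ] ℂ) (z : ℂ) :
    Integrable (fun x ↦ gaussFn B (proj N x) * Complex.exp (z * L (proj N x))) (gaussian H) :=
  integrable_mul_exp (measurable_gaussFn_proj B N).aestronglyMeasurable
    (measurable_map_proj L N).aestronglyMeasurable
    (integrable_norm_gaussFn_mul_exp_norm hB hi L) z

/-- Translation invariance of Gaussian integrals, for the complex vector `h + z k`. -/
theorem integral_gaussFn_mul_exp (hB : ∀ x y, B x y = B y x)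
    (hi : Integrable (fun x ↦ gaussFn B (proj N x)) (gaussian H)) {h k : H} (hh : h ∈ N.1)
    (hk : k ∈ N.1) (z : ℂ) :
    ∫ x, gaussFn B (proj N x) * Complex.exp (B (proj N x) h + z * B (proj N x) k) ∂(gaussian H) =
      Complex.exp ((B h h + 2 * z * B h k + z ^ 2 * B k k) / 2) *
        ∫ x, gaussFn B (proj N x) ∂(gaussian H) := by
  have hm := measurable_gaussFn_proj B N
  have hd := differentiable_integral_mul_exp (μ := gaussian H)
    (F := fun x ↦ gaussFn B (proj N x) * Complex.exp (B (proj N x) h))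
    (X := fun x ↦ B (proj N x) k)
    (hm.mul (Complex.measurable_exp.comp (measurable_map_proj (B.flip h) N))).aestronglyMeasurable
    (measurable_map_proj (B.flip k) N).aestronglyMeasurable fun R ↦ by
      -- The product of the two exponentials is bounded by the sum of their squares, which explains
      -- the doubled exponents.
      have h1 := integrable_norm_gaussFn_mul_exp_norm hB hi (B.flip k) (2 * R)
      have h2 := integrable_norm_gaussFn_mul_exp hB hi ((2 : ℝ) • Complex.reLm ∘ₗ B.flip h)
      refine (h2.add h1).mono' (((hm.mul (Complex.measurable_exp.comp
        (measurable_map_proj (B.flip h) N))).norm.mul (Real.measurable_exp.comp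
          ((measurable_map_proj (B.flip k) N).norm.const_mul R))).aestronglyMeasurable)
        (Eventually.of_forall fun x ↦ ?_)
      simp only [Pi.add_apply, LinearMap.smul_apply, LinearMap.comp_apply, Complex.reLm_coe,
        LinearMap.flip_apply, smul_eq_mul, ← mul_add]
      rw [norm_mul, norm_norm, norm_mul, mul_assoc, Real.norm_of_nonneg (Real.exp_pos _).le,
        Complex.norm_exp]
      refine mul_le_mul_of_nonneg_left ?_ (norm_nonneg _)
      rw [two_mul, mul_assoc, two_mul, Real.exp_add, Real.exp_add]
      nlinarith [sq_nonneg (Real.exp (B (proj N x) h).re - Real.exp (R * ‖B (proj N x) k‖)),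
        Real.exp_pos (B (proj N x) h).re, Real.exp_pos (R * ‖B (proj N x) k‖)]
  -- For real `z = t` this is invariance under the real translation by `h + t k`; the identity
  -- theorem gives complex `z`.
  have key := Differentiable.eq_of_eq_ofReal hd (g := fun z ↦
    Complex.exp ((B h h + 2 * z * B h k + z ^ 2 * B k k) / 2) *
        ∫ x, gaussFn B (proj N x) ∂(gaussian H)) (by fun_prop) fun t ↦ by
      have hmem : h + t • k ∈ N.1 := N.1.add_mem hh (N.1.smul_mem t hk)
      rw [← integral_shift N hmem hm]
      simp only [shift_gaussFn hB, Complex.exp_sub, ← mul_div_assoc]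
      rw [integral_div, mul_div_assoc']
      rw [eq_div_iff (Complex.exp_ne_zero _), mul_comm]
      congr 1
      · congr 1
        simp [hB k h]; ring
      · congr 1
        funext x
        rw [mul_assoc, ← Complex.exp_add]
        simp
  have := congrFun key z
  simp only [mul_assoc, ← Complex.exp_add] at this ⊢
  exact this

end GaussFn

end HatSpace

/-! ## Integrability along the finite dimensional subspaces -/

namespace HatSpace

section L1Limits

variable {H : Type u} [NormedAddCommGroup H] [InnerProductSpace ℝ H]

/-- The finite dimensional subspace spanned by a vector. -/
noncomputable def spanFinSub (h : H) : FinSub H := ⟨ℝ ∙ h, inferInstance⟩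

theorem mem_of_spanFinSub_le {h : H} {N : FinSub H} (hN : spanFinSub h ≤ N) : h ∈ N.1 :=
  (show (ℝ ∙ h) ≤ N.1 from hN) (Submodule.mem_span_singleton_self h)

variable [CompleteSpace H]

theorem HatIntegrable.tendsto_integral {f : H → ℂ} (hf : HatIntegrable f) :
    Tendsto (fun N : FinSub H ↦ ∫ x, f (proj N x) ∂(gaussian H)) atTop (𝓝 (hatIntegral f)) := by
  rw [hatIntegral, dif_pos hf]
  have hF := hf.choose_spec
  rw [tendsto_iff_norm_sub_tendsto_zero]
  refine squeeze_zero' (Eventually.of_forall fun _ ↦ norm_nonneg _) ?_ hF.tendsto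
  filter_upwards [hF.integrable_cylinder] with N hN
  rw [← integral_sub hN hF.integrable]
  exact norm_integral_le_integral_norm _

theorem integral_norm_sub_le {Ω : Type*} [MeasurableSpace Ω] {μ : Measure Ω} {f g h : Ω → ℂ}
    (hf : Integrable f μ) (hg : Integrable g μ) (hh : Integrable h μ) :
    ∫ x, ‖f x - h x‖ ∂μ ≤ ∫ x, ‖f x - g x‖ ∂μ + ∫ x, ‖g x - h x‖ ∂μ := by
  have h1 : Integrable (fun x ↦ ‖f x - g x‖) μ := (hf.sub hg).norm
  have h2 : Integrable (fun x ↦ ‖g x - h x‖) μ := (hg.sub hh).norm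
  rw [← integral_add h1 h2]
  exact integral_mono (hf.sub hh).norm (h1.add h2) fun x ↦
    norm_sub_le_norm_sub_add_norm_sub _ _ _

/-- The Cauchy criterion for integrability on `Ĥ`. -/
theorem hatIntegrable_iff_cauchy {f : H → ℂ} :
    HatIntegrable f ↔ ∀ ε > 0, ∃ N₀ : FinSub H, ∀ N ≥ N₀,
      Integrable (fun x ↦ f (proj N x)) (gaussian H) ∧
        ∀ N' ≥ N₀, ∫ x, ‖f (proj N x) - f (proj N' x)‖ ∂(gaussian H) < ε := by
  classical
  constructor
  · rintro ⟨F, hF⟩ ε hε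
    obtain ⟨N₀, hN₀⟩ := eventually_atTop.1
      (hF.integrable_cylinder.and (hF.tendsto.eventually_lt_const (half_pos hε)))
    refine ⟨N₀, fun N hN ↦ ⟨(hN₀ N hN).1, fun N' hN' ↦ ?_⟩⟩
    refine (integral_norm_sub_le (hN₀ N hN).1 hF.integrable (hN₀ N' hN').1).trans_lt ?_
    have h1 := (hN₀ N hN).2
    have h2 := (hN₀ N' hN').2
    simp only [norm_sub_rev (F _)]
    linarith
  · intro h
    -- The value `0` at nonintegrable `N` is harmless, since all sufficiently large `N` are
    -- integrable. Completeness of L¹ supplies the limit.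
    let u : FinSub H → Lp ℂ 1 (gaussian H) := fun N ↦
      if hN : Integrable (fun x ↦ f (proj N x)) (gaussian H) then hN.toL1 _ else 0
    have hu : ∀ N (hN : Integrable (fun x ↦ f (proj N x)) (gaussian H)), u N = hN.toL1 _ :=
      fun N hN ↦ dif_pos hN
    have hc : CauchySeq u := by
      refine Metric.cauchySeq_iff.2 fun ε hε ↦ ?_
      obtain ⟨N₀, hN₀⟩ := h ε hε
      refine ⟨N₀, fun N hN N' hN' ↦ ?_⟩
      rw [hu N (hN₀ N hN).1, hu N' (hN₀ N' hN').1, dist_eq_norm, ← Integrable.toL1_sub,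
        L1.norm_of_fun_eq_integral_norm]
      exact (hN₀ N hN).2 N' hN'
    obtain ⟨F, hF⟩ := cauchySeq_tendsto_of_complete hc
    have hev : ∀ᶠ N : FinSub H in atTop, Integrable (fun x ↦ f (proj N x)) (gaussian H) := by
      obtain ⟨N₀, hN₀⟩ := h 1 one_pos
      exact eventually_atTop.2 ⟨N₀, fun N hN ↦ (hN₀ N hN).1⟩
    refine ⟨F, L1.integrable_coeFn F, hev, ?_⟩
    refine (tendsto_iff_norm_sub_tendsto_zero.1 hF).congr' ?_
    filter_upwards [hev] with N hN
    rw [hu N hN, L1.norm_eq_integral_norm]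
    refine integral_congr_ae ?_
    filter_upwards [Lp.coeFn_sub (hN.toL1 _) F, hN.coeFn_toL1] with x h1 h2
    rw [h1, Pi.sub_apply, h2]

theorem HatIntegrable.const_mul {f : H → ℂ} (hf : HatIntegrable f) (c : ℂ) :
    HatIntegrable fun ξ ↦ c * f ξ := by
  obtain ⟨F, hF⟩ := hf
  refine ⟨fun x ↦ c * F x, hF.integrable.const_mul c, ?_, ?_⟩
  · filter_upwards [hF.integrable_cylinder] with N hN using hN.const_mul c
  · simp only [← mul_sub, norm_mul, integral_const_mul]
    simpa using hF.tendsto.const_mul ‖c‖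

theorem HatIntegrable.shift {f : H → ℂ} (hm : ∀ N : FinSub H, Measurable fun x ↦ f (proj N x))
    (hf : HatIntegrable f) (h : H) : HatIntegrable (shift h f) := by
  rw [hatIntegrable_iff_cauchy] at hf ⊢
  intro ε hε
  obtain ⟨N₀, hN₀⟩ := hf ε hε
  refine ⟨N₀ ⊔ spanFinSub h, fun N hN ↦ ?_⟩
  have hmem : ∀ N ≥ N₀ ⊔ spanFinSub h, h ∈ N.1 := fun N hN ↦
    mem_of_spanFinSub_le (le_sup_right.trans hN)
  refine ⟨integrable_shift N (hmem N hN) (hm N) (hN₀ N (le_sup_left.trans hN)).1, fun N' hN' ↦ ?_⟩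
  rw [integral_norm_shift_sub_shift N N' (hmem N hN) (hmem N' hN') (hm N) (hm N')]
  exact (hN₀ N (le_sup_left.trans hN)).2 N' (le_sup_left.trans hN')

end L1Limits

/-! ### Stability of integrability under complex translations -/

section ComplexTranslation

variable {H : Type u} [NormedAddCommGroup H] [InnerProductSpace ℝ H]
  {B : H →ₗ[ℝ] H →ₗ[ℝ] ℂ}

/-- The Gaussian function of the form `B`, translated by the complex vector `a + i b`. -/
noncomputable def complexShift (B : H →ₗ[ℝ] H →ₗ[ℝ] ℂ) (a b : H) (ξ : H) : ℂ :=
  gaussFn B ξ * Complex.exp (B ξ a + Complex.I * B ξ b -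
    (B a a + 2 * Complex.I * B a b - B b b) / 2)

/-- Separates the isometric real translation by `a` from the imaginary one, which is only a
multiplication by an exponential and carries all the difficulty. -/
theorem complexShift_eq_shift (hB : ∀ x y, B x y = B y x) (a b ξ : H) :
    complexShift B a b ξ = Complex.exp (B b b / 2) *
      shift a (fun ξ ↦ gaussFn B ξ * Complex.exp (Complex.I * B ξ b)) ξ := by
  have h1 := shift_gaussFn hB a ξ
  rw [shift] at h1 ⊢
  rw [← mul_assoc (Real.exp _ : ℂ), h1, complexShift, mul_assoc (gaussFn B ξ), ← Complex.exp_add, mul_left_comm,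
    ← Complex.exp_add]
  simp only [map_sub, LinearMap.sub_apply]
  ring_nf

variable [CompleteSpace H]

/-- Dominated convergence at a single `N`; uniformity in `N` comes later from the isometry property.
-/
theorem tendsto_integral_norm_shift_sub (hB : ∀ x y, B x y = B y x) {N : FinSub H}
    (hi : Integrable (fun x ↦ gaussFn B (proj N x)) (gaussian H)) (b : H) :
    Tendsto (fun t : ℝ ↦ ∫ x, ‖shift (t • b) (gaussFn B) (proj N x) - gaussFn B (proj N x)‖
      ∂(gaussian H)) (𝓝 0) (𝓝 0) := by
  have hm := measurable_gaussFn_proj B N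
  have hL := measurable_map_proj (B.flip b) N
  have hsh : ∀ (t : ℝ) x, ‖shift (t • b) (gaussFn B) (proj N x) - gaussFn B (proj N x)‖ =
      ‖gaussFn B (proj N x)‖ * ‖Complex.exp (t * B (proj N x) b - t ^ 2 * B b b / 2) - 1‖ := by
    intro t x
    rw [shift_gaussFn hB, ← norm_mul, mul_sub, mul_one]
    simp only [map_smul, LinearMap.smul_apply, Complex.real_smul]
    ring_nf
  simp only [hsh]
  suffices h : Tendsto (fun t : ℝ ↦ ∫ x, ‖gaussFn B (proj N x)‖ *
      ‖Complex.exp (t * B (proj N x) b - t ^ 2 * B b b / 2) - 1‖ ∂(gaussian H)) (𝓝 0)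
      (𝓝 (∫ _ : HatSpace H, (0 : ℝ) ∂(gaussian H))) by rwa [integral_zero] at h
  have hbd := integrable_norm_gaussFn_mul_exp_norm hB hi (B.flip b) 1
  refine tendsto_integral_filter_of_dominated_convergence
    (fun x ↦ Real.exp (‖B b b‖ / 2) * (‖gaussFn B (proj N x)‖ *
      Real.exp (1 * ‖B.flip b (proj N x)‖)) + ‖gaussFn B (proj N x)‖)
    (Eventually.of_forall fun t ↦ ?_) ?_ ((hbd.const_mul _).add hi.norm)
    (Eventually.of_forall fun x ↦ ?_)
  · exact (hm.norm.mul ((Complex.measurable_exp.comp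
      ((hL.const_mul (t : ℂ)).sub_const _)).sub_const 1).norm).aestronglyMeasurable
  · filter_upwards [Metric.ball_mem_nhds (0 : ℝ) one_pos] with t ht
    have ht1 : |t| ≤ 1 := by simpa using (mem_ball_zero_iff.1 ht).le
    refine Eventually.of_forall fun x ↦ ?_
    rw [norm_mul, norm_norm, norm_norm, mul_left_comm, ← mul_add_one]
    refine mul_le_mul_of_nonneg_left ((norm_sub_le _ _).trans ?_) (norm_nonneg _)
    rw [norm_one, ← Real.exp_add, Complex.norm_exp]
    refine add_le_add_left (Real.exp_le_exp.2 ((Complex.re_le_norm _).trans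
      ((norm_sub_le _ _).trans ?_))) 1
    rw [norm_div, norm_mul, norm_mul, norm_pow, Complex.norm_real, Real.norm_eq_abs,
      Complex.norm_ofNat, add_comm, LinearMap.flip_apply]
    have h2 : |t| ^ 2 ≤ 1 := pow_le_one₀ (abs_nonneg _) ht1
    gcongr
    exact mul_le_of_le_one_left (norm_nonneg _) h2
  · have : Continuous fun t : ℝ ↦ ‖gaussFn B (proj N x)‖ *
        ‖Complex.exp (t * B (proj N x) b - t ^ 2 * B b b / 2) - 1‖ := by fun_prop
    exact this.tendsto' 0 0 (by simp)

/-- A nonzero limit of the Gaussian integrals controls the imaginary part of the form by its real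
part. -/
theorem exists_eventually_re_le (hB : ∀ x y, B x y = B y x) (hf : HatIntegrable (gaussFn B))
    (h0 : hatIntegral (gaussFn B) ≠ 0) (b : H) :
    ∃ C : ℝ, 0 ≤ C ∧ ∀ᶠ N : FinSub H in atTop, ∀ h ∈ N.1,
      (∀ x ∈ N.1, (B x h).re = (B x b).im) → (B h h).re ≤ C := by
  set m := ‖hatIntegral (gaussFn B)‖ / 2 with hmdef
  have hm0 : 0 < ‖hatIntegral (gaussFn B)‖ := norm_pos_iff.2 h0
  obtain ⟨N₁, hN₁⟩ := eventually_atTop.1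
    (hf.tendsto_integral.norm.eventually_const_lt (half_lt_self hm0))
  -- Three errors below `m / 8` (two changes of subspace, one translation at `N₀`) add up to less
  -- than `m / 2`.
  obtain ⟨N₂, hN₂⟩ := hatIntegrable_iff_cauchy.1 hf (m / 8) (by positivity)
  set N₀ := N₂ ⊔ spanFinSub b
  have hb : ∀ N ≥ N₀, b ∈ N.1 := fun N hN ↦ mem_of_spanFinSub_le (le_sup_right.trans hN)
  have hi₀ := (hN₂ N₀ le_sup_left).1
  have hev := (tendsto_integral_norm_shift_sub hB hi₀ b).eventually_lt_const
    (show (0 : ℝ) < m / 8 by positivity)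
  obtain ⟨t, ht, ht0⟩ := ((hev.filter_mono nhdsWithin_le_nhds).and
    (self_mem_nhdsWithin : {(0 : ℝ)}ᶜ ∈ 𝓝[≠] 0)).exists
  have ht2 : 0 < t ^ 2 := by
    have : t ≠ 0 := ht0
    positivity
  -- The constant expresses `exp(-t² s / 2) > 1/2`, obtained below for `s = Re B(h, h)`.
  refine ⟨2 * Real.log 2 / t ^ 2, by positivity, ?_⟩
  filter_upwards [eventually_ge_atTop N₀, eventually_ge_atTop N₁] with N hN hN' h hh hhb
  have hi := (hN₂ N (le_sup_left.trans hN)).1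
  have hsm : ∀ M : FinSub H, M ≥ N₀ → Integrable
      (fun x ↦ shift (t • b) (gaussFn B) (proj M x)) (gaussian H) := fun M hM ↦
    integrable_shift M (M.1.smul_mem t (hb M hM)) (measurable_gaussFn_proj B M)
      (hN₂ M (le_sup_left.trans hM)).1
  have hclose : ∫ x, ‖shift (t • b) (gaussFn B) (proj N x) - gaussFn B (proj N x)‖ ∂(gaussian H)
      < m / 2 := by
    have e1 := integral_norm_sub_le (hsm N hN) (hsm N₀ le_rfl) hi
    have e2 := integral_norm_sub_le (hsm N₀ le_rfl) hi₀ hi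
    have e3 := integral_norm_shift_sub_shift N N₀ (N.1.smul_mem t (hb N hN))
      (N₀.1.smul_mem t (hb N₀ le_rfl)) (measurable_gaussFn_proj B N) (measurable_gaussFn_proj B N₀)
    have e4 := (hN₂ N (le_sup_left.trans hN)).2 N₀ le_sup_left
    have e5 := (hN₂ N₀ le_sup_left).2 N (le_sup_left.trans hN)
    have : 0 < m := by positivity
    linarith
  set I := ∫ x, ‖gaussFn B (proj N x)‖ ∂(gaussian H) with hI
  -- The nonzero limit enters here: it keeps the L¹ norms `I` away from zero.
  have hIm : m < I := (hN₁ N hN').trans_le (norm_integral_le_integral_norm _)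
  -- Translation invariance for the modulus, along the complex vector `t b + i t h`. By the choice
  -- of `h`, the exponent becomes `t B(x, b)`, so its oscillation produces the damping `exp(-t² s /
  -- 2)`.
  have hform := integral_gaussFn_mul_exp (B := reForm B)
    (fun x y ↦ by rw [reForm_apply, reForm_apply, hB]) (integrable_gaussFn_reForm hi)
    (N.1.smul_mem t (hb N hN)) (N.1.smul_mem t hh) Complex.I
  simp only [← norm_gaussFn] at hform
  rw [integral_complex_ofReal, ← hI] at hform
  have hexp : ∀ x, reForm B (proj N x) (t • b) + Complex.I * reForm B (proj N x) (t • h) =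
      t * B (proj N x) b := fun x ↦ by
    rw [map_smul, map_smul, reForm_apply, reForm_apply, hhb _ (proj_mem N x)]
    simp only [Complex.real_smul]
    conv_rhs => rw [← Complex.re_add_im (B (proj N x) b)]
    ring
  simp only [hexp] at hform
  set s := (B h h).re
  have hle : I - Real.exp (-(t ^ 2 * s / 2)) * I < m / 2 := by
    -- The phase of `gaussFn B` is common to both terms and drops out of the norm.
    have e1 : ∀ x, ‖shift (t • b) (gaussFn B) (proj N x) - gaussFn B (proj N x)‖ =
        ‖(‖gaussFn B (proj N x)‖ : ℂ) * Complex.exp (t * B (proj N x) b) *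
          Complex.exp (-(t ^ 2 * B b b / 2)) - (‖gaussFn B (proj N x)‖ : ℂ)‖ := fun x ↦ by
      rw [shift_gaussFn hB, mul_assoc, ← Complex.exp_add, ← mul_sub_one, ← mul_sub_one, norm_mul,
        norm_mul, Complex.norm_real, norm_norm]
      simp only [map_smul, LinearMap.smul_apply, Complex.real_smul]
      ring_nf
    simp only [e1] at hclose
    have hi1 : Integrable (fun x ↦ (‖gaussFn B (proj N x)‖ : ℂ) *
        Complex.exp (t * B (proj N x) b)) (gaussian H) := by
      have := integrable_gaussFn_mul_exp (B := reForm B) (N := N)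
        (fun x y ↦ by rw [reForm_apply, reForm_apply, hB]) (integrable_gaussFn_reForm hi)
        (B.flip b) t
      exact this.congr (Eventually.of_forall fun x ↦ by
        dsimp only
        rw [norm_gaussFn, LinearMap.flip_apply])
    have hi2 : Integrable (fun x ↦ (‖gaussFn B (proj N x)‖ : ℂ)) (gaussian H) := hi.norm.ofReal
    have e2 := (norm_integral_le_integral_norm _).trans_lt hclose
    rw [integral_sub (hi1.mul_const _) hi2, integral_mul_const, hform, integral_complex_ofReal,
      ← hI, mul_right_comm, ← Complex.exp_add] at e2
    have e3 := (norm_sub_norm_le _ _).trans_lt ((norm_sub_rev _ _).trans_lt e2)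
    have hI0 : 0 ≤ I := integral_nonneg fun _ ↦ norm_nonneg _
    rw [norm_mul, Complex.norm_real, Real.norm_of_nonneg hI0, Complex.norm_exp] at e3
    refine lt_of_eq_of_lt ?_ e3
    congr 3
    simp [reForm_apply, s, ← Complex.ofReal_pow]
    ring
  have hhalf : Real.exp (-(Real.log 2)) < Real.exp (-(t ^ 2 * s / 2)) := by
    rw [Real.exp_neg, Real.exp_log two_pos]
    have : 0 < m := by positivity
    by_contra! hcon
    nlinarith
  have := Real.exp_lt_exp.1 hhalf
  rw [le_div_iff₀ ht2]
  linarith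

/-- With `h` representing `Im B(·, b)`, the modulus of the exponential is that of the real
translation by `t.re b - t.im h`. The cross term in its quadratic form is removed by adding the
nonnegative value at `t.re b + t.im h`. -/
theorem integral_norm_gaussFn_mul_exp_le (hB : ∀ x y, B x y = B y x) {N : FinSub H}
    (hi : Integrable (fun x ↦ gaussFn B (proj N x)) (gaussian H)) {b : H} (hb : b ∈ N.1) {C : ℝ}
    (hC : ∀ h ∈ N.1, (∀ x ∈ N.1, (B x h).re = (B x b).im) → (B h h).re ≤ C) (t : ℂ) :
    ∫ x, ‖gaussFn B (proj N x) * Complex.exp (t * B (proj N x) b)‖ ∂(gaussian H) ≤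
      Real.exp (t.re ^ 2 * (B b b).re + t.im ^ 2 * C) *
        ∫ x, ‖gaussFn B (proj N x)‖ ∂(gaussian H) := by
  obtain ⟨h, hh, hhb⟩ := exists_re_eq_of_integrable_gaussFn hB hi (Complex.imLm ∘ₗ B.flip b)
  have hs := hC h hh hhb
  have hmem : t.re • b - t.im • h ∈ N.1 :=
    N.1.sub_mem (N.1.smul_mem _ hb) (N.1.smul_mem _ hh)
  have hmem' : t.re • b + t.im • h ∈ N.1 :=
    N.1.add_mem (N.1.smul_mem _ hb) (N.1.smul_mem _ hh)
  have hpos : 0 ≤ (B (t.re • b + t.im • h) (t.re • b + t.im • h)).re := by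
    rcases eq_or_ne (t.re • b + t.im • h) 0 with h0 | h0
    · rw [h0]; simp
    · exact (re_pos_of_integrable_gaussFn hB hi hmem' h0).le
  have e1 : ∀ x, ‖gaussFn B (proj N x) * Complex.exp (t * B (proj N x) b)‖ =
      ‖gaussFn B (proj N x)‖ * Real.exp (B (proj N x) (t.re • b - t.im • h)).re := fun x ↦ by
    rw [norm_mul, Complex.norm_exp, Complex.mul_re, map_sub, map_smul, map_smul, Complex.sub_re,
      Complex.smul_re, Complex.smul_re, hhb _ (proj_mem N x)]
    rfl
  simp only [e1]
  rw [integral_norm_gaussFn_mul_exp hB hmem]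
  refine mul_le_mul_of_nonneg_right (Real.exp_le_exp.2 ?_)
    (integral_nonneg fun _ ↦ norm_nonneg _)
  simp only [map_add, map_sub, map_smul, LinearMap.add_apply, LinearMap.sub_apply,
    LinearMap.smul_apply, Complex.add_re, Complex.sub_re, Complex.smul_re, smul_eq_mul] at hpos ⊢
  nlinarith [mul_le_mul_of_nonneg_left hs (sq_nonneg t.im)]

/-- For real `t` the exponential is, up to a constant of modulus `exp(t² Re B(b,b) / 2)`, the
translation by `t b`, an L¹ isometry. -/
theorem integral_norm_gaussFn_mul_exp_sub (hB : ∀ x y, B x y = B y x) {N N' : FinSub H} {b : H}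
    (hb : b ∈ N.1) (hb' : b ∈ N'.1) (t : ℝ) :
    ∫ x, ‖gaussFn B (proj N x) * Complex.exp (t * B (proj N x) b) -
        gaussFn B (proj N' x) * Complex.exp (t * B (proj N' x) b)‖ ∂(gaussian H) =
      Real.exp (t ^ 2 * (B b b).re / 2) *
        ∫ x, ‖gaussFn B (proj N x) - gaussFn B (proj N' x)‖ ∂(gaussian H) := by
  rw [← integral_norm_shift_sub_shift N N' (N.1.smul_mem t hb) (N'.1.smul_mem t hb')
    (measurable_gaussFn_proj B N) (measurable_gaussFn_proj B N'), ← integral_const_mul]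
  refine integral_congr_ae (Eventually.of_forall fun x ↦ ?_)
  have e : Real.exp (t ^ 2 * (B b b).re / 2) = ‖Complex.exp (t ^ 2 * B b b / 2)‖ := by
    rw [Complex.norm_exp]
    congr 1
    rw [← Complex.ofReal_pow, ← Complex.ofReal_ofNat, Complex.div_ofReal_re,
      Complex.re_ofReal_mul]
  simp only
  rw [e, ← norm_mul, shift_gaussFn hB, shift_gaussFn hB, mul_sub, mul_left_comm,
    mul_left_comm (Complex.exp _), ← Complex.exp_add, ← Complex.exp_add]
  simp only [map_smul, LinearMap.smul_apply, Complex.real_smul]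
  ring_nf

theorem differentiable_integral_weight_mul (hB : ∀ x y, B x y = B y x) {N : FinSub H}
    (hi : Integrable (fun x ↦ gaussFn B (proj N x)) (gaussian H)) (b : H) {φ : HatSpace H → ℂ}
    (hφ : Measurable φ) (hφ1 : ∀ x, ‖φ x‖ ≤ 1) :
    Differentiable ℂ fun t : ℂ ↦
      ∫ x, φ x * gaussFn B (proj N x) * Complex.exp (t * B (proj N x) b) ∂(gaussian H) := by
  have hm := measurable_gaussFn_proj B N
  have hL := measurable_map_proj (B.flip b) N
  refine differentiable_integral_mul_exp (X := fun x ↦ B (proj N x) b)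
    (hφ.mul hm).aestronglyMeasurable hL.aestronglyMeasurable fun R ↦ ?_
  refine (integrable_norm_gaussFn_mul_exp_norm hB hi (B.flip b) R).mono'
    ((hφ.mul hm).norm.mul (Real.measurable_exp.comp
      (hL.norm.const_mul R))).aestronglyMeasurable (Eventually.of_forall fun x ↦ ?_)
  rw [norm_mul, norm_norm, norm_mul, Real.norm_of_nonneg (Real.exp_pos _).le]
  exact mul_le_mul_of_nonneg_right (mul_le_of_le_one_left (norm_nonneg _) (hφ1 x))
    (Real.exp_pos _).le

/-- Interpolation between real translations, which act isometrically, and imaginary ones. -/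
theorem integral_norm_sub_le_interp (hB : ∀ x y, B x y = B y x) {N N' : FinSub H}
    (hi : Integrable (fun x ↦ gaussFn B (proj N x)) (gaussian H))
    (hi' : Integrable (fun x ↦ gaussFn B (proj N' x)) (gaussian H)) {b : H} (hb : b ∈ N.1)
    (hb' : b ∈ N'.1) {C : ℝ} (hC0 : 0 ≤ C)
    (hC : ∀ h ∈ N.1, (∀ x ∈ N.1, (B x h).re = (B x b).im) → (B h h).re ≤ C)
    (hC' : ∀ h ∈ N'.1, (∀ x ∈ N'.1, (B x h).re = (B x b).im) → (B h h).re ≤ C) :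
    ∫ x, ‖gaussFn B (proj N x) * Complex.exp (Complex.I * B (proj N x) b) -
        gaussFn B (proj N' x) * Complex.exp (Complex.I * B (proj N' x) b)‖ ∂(gaussian H) ≤
      (∫ x, ‖gaussFn B (proj N x) - gaussFn B (proj N' x)‖ ∂(gaussian H)) ^ (1 / 2 : ℝ) *
        (Real.exp (4 * (B b b).re + 4 * C) * (∫ x, ‖gaussFn B (proj N x)‖ ∂(gaussian H) +
          ∫ x, ‖gaussFn B (proj N' x)‖ ∂(gaussian H))) ^ (1 / 2 : ℝ) := by
  set β := (B b b).re with hβ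
  have hβ0 : 0 ≤ β := by
    rcases eq_or_ne b 0 with h0 | h0
    · rw [hβ, h0]; simp
    · exact (re_pos_of_integrable_gaussFn hB hi hb h0).le
  set δ := ∫ x, ‖gaussFn B (proj N x) - gaussFn B (proj N' x)‖ ∂(gaussian H)
  have hδ0 : 0 ≤ δ := integral_nonneg fun _ ↦ norm_nonneg _
  set J := ∫ x, ‖gaussFn B (proj N x)‖ ∂(gaussian H) +
    ∫ x, ‖gaussFn B (proj N' x)‖ ∂(gaussian H)
  have hJ0 : 0 ≤ J := add_nonneg (integral_nonneg fun _ ↦ norm_nonneg _)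
    (integral_nonneg fun _ ↦ norm_nonneg _)
  let G : ℂ → HatSpace H → ℂ := fun t x ↦
    gaussFn B (proj N x) * Complex.exp (t * B (proj N x) b) -
      gaussFn B (proj N' x) * Complex.exp (t * B (proj N' x) b)
  have hGi : ∀ t, Integrable (G t) (gaussian H) := fun t ↦
    (integrable_gaussFn_mul_exp hB hi (B.flip b) t).sub
      (integrable_gaussFn_mul_exp hB hi' (B.flip b) t)
  have hGm : ∀ t, Measurable (G t) := fun t ↦
    ((measurable_gaussFn_proj B N).mul (Complex.measurable_exp.comp
      ((measurable_map_proj (B.flip b) N).const_mul t))).sub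
    ((measurable_gaussFn_proj B N').mul (Complex.measurable_exp.comp
      ((measurable_map_proj (B.flip b) N').const_mul t)))
  -- The conjugate phase of the difference at `t = i`. Pairing with this fixed bounded weight gives
  -- a holomorphic `W` whose modulus at `i` is the L¹ norm, and elsewhere at most that norm.
  let φ : HatSpace H → ℂ := fun x ↦ (starRingEnd ℂ) (G Complex.I x) / (‖G Complex.I x‖ : ℝ)
  have hφm : Measurable φ := (Complex.continuous_conj.measurable.comp (hGm _)).div
    (Complex.measurable_ofReal.comp (hGm _).norm)
  have hφ1 : ∀ x, ‖φ x‖ ≤ 1 := fun x ↦ by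
    simp only [φ, norm_div, RCLike.norm_conj, Complex.norm_real, norm_norm]
    exact div_self_le_one _
  have hφG : ∀ x, φ x * G Complex.I x = (‖G Complex.I x‖ : ℝ) := fun x ↦ by
    simp only [φ]
    rw [div_mul_eq_mul_div, Complex.conj_mul', ← Complex.ofReal_pow, ← Complex.ofReal_div, sq,
      mul_self_div_self]
  have hφGi : ∀ t, Integrable (fun x ↦ φ x * G t x) (gaussian H) := fun t ↦
    (hGi t).norm.mono' (hφm.mul (hGm t)).aestronglyMeasurable (Eventually.of_forall fun x ↦ by
      rw [norm_mul]; exact mul_le_of_le_one_left (norm_nonneg _) (hφ1 x))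
  let W : ℂ → ℂ := fun t ↦ ∫ x, φ x * G t x ∂(gaussian H)
  have hWle : ∀ t, ‖W t‖ ≤ ∫ x, ‖G t x‖ ∂(gaussian H) := fun t ↦
    (norm_integral_le_integral_norm _).trans (integral_mono (hφGi t).norm (hGi t).norm fun x ↦ by
      simp only [norm_mul]
      exact mul_le_of_le_one_left (norm_nonneg _) (hφ1 x))
  have hWd : Differentiable ℂ W := by
    have := (differentiable_integral_weight_mul hB hi b hφm hφ1).sub
      (differentiable_integral_weight_mul hB hi' b hφm hφ1)
    refine (funext fun t ↦ ?_ : W = _) ▸ this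
    have hw : ∀ {N : FinSub H}, Integrable (fun x ↦ gaussFn B (proj N x)) (gaussian H) →
        Integrable (fun x ↦ φ x * gaussFn B (proj N x) * Complex.exp (t * B (proj N x) b))
          (gaussian H) := fun {N} hi ↦ by
      refine (integrable_gaussFn_mul_exp hB hi (B.flip b) t).norm.mono'
        ((hφm.mul (measurable_gaussFn_proj B N)).mul (Complex.measurable_exp.comp
          ((measurable_map_proj (B.flip b) N).const_mul t))).aestronglyMeasurable
        (Eventually.of_forall fun x ↦ ?_)
      rw [mul_assoc, norm_mul]
      exact mul_le_of_le_one_left (norm_nonneg _) (hφ1 x)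
    rw [Pi.sub_apply, ← integral_sub (hw hi) (hw hi')]
    simp only [W, G, mul_sub, mul_assoc]
  have hWbound : ∀ t : ℂ, ‖W t‖ ≤ Real.exp (t.re ^ 2 * β + t.im ^ 2 * C) * J := fun t ↦ by
    refine (hWle t).trans ?_
    have i1 := (integrable_gaussFn_mul_exp hB hi (B.flip b) t).norm
    have i2 := (integrable_gaussFn_mul_exp hB hi' (B.flip b) t).norm
    refine (integral_mono (hGi t).norm (i1.add i2) fun x ↦ norm_sub_le _ _).trans ?_
    simp only [Pi.add_apply]
    rw [integral_add i1 i2, mul_add]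
    exact add_le_add (integral_norm_gaussFn_mul_exp_le hB hi hb hC t)
      (integral_norm_gaussFn_mul_exp_le hB hi' hb' hC' t)
  -- With `t = 2 i z`, the edge `Re z = 0` is the real `t`-axis, `Re z = 1` is `Im t = 2`, and `z =
  -- 1/2` is `t = i`. The factor `exp(-β t²)` cancels the growth in `Re t`.
  let f : ℂ → ℂ := fun z ↦ Complex.exp (-(β * (2 * Complex.I * z) ^ 2)) * W (2 * Complex.I * z)
  have hre : ∀ z : ℂ, (2 * Complex.I * z).re = -2 * z.im := fun z ↦ by simp
  have him : ∀ z : ℂ, (2 * Complex.I * z).im = 2 * z.re := fun z ↦ by simp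
  have hfn : ∀ z, ‖f z‖ = Real.exp (-(β * (4 * z.im ^ 2 - 4 * z.re ^ 2))) *
      ‖W (2 * Complex.I * z)‖ := fun z ↦ by
    simp only [f]
    rw [norm_mul, Complex.norm_exp]
    congr 2
    rw [Complex.neg_re, Complex.re_ofReal_mul, sq (2 * Complex.I * z), Complex.mul_re, hre, him]
    ring
  have hfb : ∀ z ∈ Complex.HadamardThreeLines.verticalClosedStrip 0 1,
      ‖f z‖ ≤ Real.exp (4 * β + 4 * C) * J := fun z hz ↦ by
    obtain ⟨hz0, hz1⟩ : 0 ≤ z.re ∧ z.re ≤ 1 := hz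
    rw [hfn]
    refine (mul_le_mul_of_nonneg_left (hWbound _) (Real.exp_pos _).le).trans ?_
    rw [← mul_assoc, ← Real.exp_add, hre, him]
    refine mul_le_mul_of_nonneg_right (Real.exp_le_exp.2 ?_) hJ0
    have h1 : z.re ^ 2 ≤ 1 := pow_le_one₀ hz0 hz1
    nlinarith [mul_le_mul_of_nonneg_left h1 hβ0, mul_le_mul_of_nonneg_left h1 hC0]
  have h3 := Complex.HadamardThreeLines.norm_le_interp_of_mem_verticalClosedStrip'
    (f := f) (z := 1 / 2) (a := δ) (b := Real.exp (4 * β + 4 * C) * J) zero_lt_one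
    (by
      change (1 / 2 : ℂ).re ∈ Set.Icc (0 : ℝ) 1
      norm_num)
    (Differentiable.diffContOnCl (by fun_prop))
    ⟨_, by rintro _ ⟨z, hz, rfl⟩; exact hfb z hz⟩
    (fun z hz ↦ by
      have hz' : z.re = 0 := hz
      have hreal : 2 * Complex.I * z = ((-2 * z.im : ℝ) : ℂ) :=
        Complex.ext (by rw [hre, Complex.ofReal_re]) (by rw [him, hz', Complex.ofReal_im, mul_zero])
      rw [hfn]
      have h1 := (hWle (2 * Complex.I * z))
      rw [hreal] at h1
      rw [hreal]
      refine (mul_le_mul_of_nonneg_left (h1.trans_eq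
        (integral_norm_gaussFn_mul_exp_sub hB hb hb' (-2 * z.im))) (Real.exp_pos _).le).trans ?_
      rw [← mul_assoc, ← Real.exp_add]
      refine mul_le_of_le_one_left hδ0 (Real.exp_le_one_iff.2 ?_)
      rw [hz', ← hβ]
      nlinarith [mul_nonneg hβ0 (sq_nonneg z.im)])
    (fun z hz ↦ hfb z (by
      have hz' : z.re = 1 := hz
      change z.re ∈ Set.Icc (0 : ℝ) 1
      rw [hz']; norm_num))
  have hhalf : (1 - ((1 / 2 : ℂ).re - 0) / (1 - 0) : ℝ) = 1 / 2 ∧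
      (((1 / 2 : ℂ).re - 0) / (1 - 0) : ℝ) = 1 / 2 := by norm_num
  rw [hhalf.1, hhalf.2, hfn] at h3
  refine le_trans ?_ h3
  have hI : 2 * Complex.I * (1 / 2) = Complex.I := by ring
  have hW : ‖W Complex.I‖ = ∫ x, ‖G Complex.I x‖ ∂(gaussian H) := by
    simp only [W, hφG]
    rw [integral_complex_ofReal, Complex.norm_real,
      Real.norm_of_nonneg (integral_nonneg fun _ ↦ norm_nonneg _)]
  rw [hI, hW]
  -- At `t = i` the damping factor is `exp β ≥ 1`, so it may be dropped.
  refine le_mul_of_one_le_left (integral_nonneg fun _ ↦ norm_nonneg _) (Real.one_le_exp ?_)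
  norm_num
  exact hβ0

/-- If the integral is nonzero, integrability is stable under imaginary translations. -/
theorem hatIntegrable_gaussFn_mul_exp (hB : ∀ x y, B x y = B y x) (hf : HatIntegrable (gaussFn B))
    (h0 : hatIntegral (gaussFn B) ≠ 0) (b : H) :
    HatIntegrable fun ξ ↦ gaussFn B ξ * Complex.exp (Complex.I * B ξ b) := by
  obtain ⟨C, hC0, hC⟩ := exists_eventually_re_le hB hf h0 b
  obtain ⟨N₁, hN₁⟩ := eventually_atTop.1 hC
  rw [hatIntegrable_iff_cauchy] at hf ⊢
  obtain ⟨N₂, hN₂⟩ := hf 1 one_pos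
  set K := Real.exp (4 * (B b b).re + 4 * C) *
    (2 * (∫ x, ‖gaussFn B (proj N₂ x)‖ ∂(gaussian H) + 1)) with hK
  have hI0 : 0 ≤ ∫ x, ‖gaussFn B (proj N₂ x)‖ ∂(gaussian H) :=
    integral_nonneg fun _ ↦ norm_nonneg _
  have hK0 : 0 < K := by positivity
  intro ε hε
  -- Interpolation takes the square root of the Cauchy difference times `K`, hence `ε² / K`.
  obtain ⟨N₃, hN₃⟩ := hf (ε ^ 2 / K) (by positivity)
  refine ⟨N₁ ⊔ N₂ ⊔ N₃ ⊔ spanFinSub b, fun N hN ↦ ?_⟩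
  have le1 : ∀ N ≥ N₁ ⊔ N₂ ⊔ N₃ ⊔ spanFinSub b, N₁ ≤ N ∧ N₂ ≤ N ∧ N₃ ≤ N ∧ b ∈ N.1 :=
    fun N hN ↦ by
      simp only [ge_iff_le, sup_le_iff] at hN
      exact ⟨hN.1.1.1, hN.1.1.2, hN.1.2, mem_of_spanFinSub_le hN.2⟩
  obtain ⟨l1, l2, l3, l4⟩ := le1 N hN
  refine ⟨integrable_gaussFn_mul_exp hB (hN₂ N l2).1 (B.flip b) Complex.I, fun N' hN' ↦ ?_⟩
  obtain ⟨r1, r2, r3, r4⟩ := le1 N' hN'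
  have hbound : ∀ N ≥ N₂, ∫ x, ‖gaussFn B (proj N x)‖ ∂(gaussian H) ≤
      ∫ x, ‖gaussFn B (proj N₂ x)‖ ∂(gaussian H) + 1 := fun N hN ↦ by
    have i1 := (hN₂ N hN).1
    have i2 := (hN₂ N₂ le_rfl).1
    have := (hN₂ N hN).2 N₂ le_rfl
    have h2 : ∫ x, ‖gaussFn B (proj N x)‖ ∂(gaussian H) ≤
        ∫ x, (‖gaussFn B (proj N₂ x)‖ + ‖gaussFn B (proj N x) - gaussFn B (proj N₂ x)‖)
          ∂(gaussian H) :=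
      integral_mono i1.norm (i2.norm.add (i1.sub i2).norm) fun x ↦
        norm_le_norm_add_norm_sub' _ _
    have i3 : Integrable (fun x ↦ ‖gaussFn B (proj N x) - gaussFn B (proj N₂ x)‖) (gaussian H) :=
      (i1.sub i2).norm
    rw [integral_add i2.norm i3] at h2
    linarith
  refine (integral_norm_sub_le_interp hB (hN₂ N l2).1 (hN₂ N' r2).1 l4 r4 hC0 (hN₁ N l1)
    (hN₁ N' r1)).trans_lt ?_
  have hδ := (hN₃ N l3).2 N' r3
  have hδ0 : 0 ≤ ∫ x, ‖gaussFn B (proj N x) - gaussFn B (proj N' x)‖ ∂(gaussian H) :=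
    integral_nonneg fun _ ↦ norm_nonneg _
  rw [← Real.sqrt_eq_rpow, ← Real.sqrt_eq_rpow]
  calc _ ≤ √(∫ x, ‖gaussFn B (proj N x) - gaussFn B (proj N' x)‖ ∂(gaussian H)) * √K := by
        refine mul_le_mul_of_nonneg_left (Real.sqrt_le_sqrt ?_) (Real.sqrt_nonneg _)
        refine mul_le_mul_of_nonneg_left ?_ (Real.exp_pos _).le
        linarith [hbound N l2, hbound N' r2]
    _ < √(ε ^ 2 / K) * √K :=
        mul_lt_mul_of_pos_right (Real.sqrt_lt_sqrt hδ0 hδ) (Real.sqrt_pos.2 hK0)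
    _ = ε := by
        rw [← Real.sqrt_mul (by positivity), div_mul_cancel₀ _ hK0.ne', Real.sqrt_sq hε.le]

theorem hatIntegrable_complexShift (hB : ∀ x y, B x y = B y x) (hf : HatIntegrable (gaussFn B))
    (h0 : hatIntegral (gaussFn B) ≠ 0) (a b : H) : HatIntegrable (complexShift B a b) := by
  have h1 := ((hatIntegrable_gaussFn_mul_exp hB hf h0 b).shift (fun N ↦
    (measurable_gaussFn_proj B N).mul (Complex.measurable_exp.comp
      ((measurable_map_proj (B.flip b) N).const_mul Complex.I))) a).const_mul
        (Complex.exp (B b b / 2))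
  exact (funext (complexShift_eq_shift hB a b)) ▸ h1

/-- The cylinder integrals agree exactly once `N` contains `a` and `b`, so the limits agree whenever
both exist, whether or not they vanish. -/
theorem hatIntegral_complexShift (hB : ∀ x y, B x y = B y x) (hf : HatIntegrable (gaussFn B))
    {a b : H} (hab : HatIntegrable (complexShift B a b)) (c : ℂ) :
    hatIntegral (fun ξ ↦ c * complexShift B a b ξ) = c * hatIntegral (gaussFn B) := by
  refine tendsto_nhds_unique (hab.const_mul c).tendsto_integral
    ((hf.tendsto_integral.const_mul c).congr' ?_)
  filter_upwards [hf.choose_spec.integrable_cylinder, eventually_ge_atTop (spanFinSub a),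
    eventually_ge_atTop (spanFinSub b)] with N hN ha hb
  rw [integral_const_mul]
  congr 1
  have := integral_gaussFn_mul_exp hB hN (mem_of_spanFinSub_le ha) (mem_of_spanFinSub_le hb)
    Complex.I
  simp only [complexShift, Complex.exp_sub, ← mul_div_assoc]
  rw [integral_div, this, Complex.I_sq, neg_one_mul, ← sub_eq_add_neg,
    mul_div_cancel_left₀ _ (Complex.exp_ne_zero _)]

end ComplexTranslation

end HatSpace

/-! ## The symplectic form on the boundary of a glued region -/

namespace PhaseSpace

/-- The elementary tensor `a ⊗ x` of the complexification. -/
noncomputable def Cx.mk {S : PhaseSpace.{u}} (a : ℂ) (x : S.carrier) : S.Cx :=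
  (a ⊗ₜ[ℝ] x : ℂ ⊗[ℝ] S.carrier)

theorem Cx.induction {S : PhaseSpace.{u}} {p : S.Cx → Prop} (h0 : p 0)
    (ht : ∀ (a : ℂ) (x : S.carrier), p (Cx.mk a x))
    (ha : ∀ x y, p x → p y → p (x + y)) (x : S.Cx) : p x :=
  TensorProduct.induction_on (motive := p) x h0 ht ha

theorem formC_mk (S : PhaseSpace.{u}) (a b : ℂ) (x y : S.carrier) :
    S.formC (Cx.mk a x) (Cx.mk b y) = (a * b) * (S.form x y : ℝ) := by
  have := LinearMap.BilinForm.baseChange_tmul (A := ℂ) S.form a x b y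
  refine this.trans ?_
  rw [Complex.real_smul, mul_comm]

theorem formC_swap (S : PhaseSpace.{u}) (x y : S.Cx) : S.formC x y = -S.formC y x := by
  induction x using Cx.induction with
  | h0 => simp
  | ha x x' hx hx' => rw [map_add, LinearMap.add_apply, hx, hx', map_add]; ring
  | ht a x =>
    induction y using Cx.induction with
    | h0 => simp
    | ha y y' hy hy' => rw [map_add, map_add, LinearMap.add_apply, hy, hy']; ring
    | ht b y =>
      rw [formC_mk, formC_mk, ← S.alt.neg_eq x y]
      push_cast
      ring

theorem formC_self (S : PhaseSpace.{u}) (x : S.Cx) : S.formC x x = 0 := by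
  have := S.formC_swap x x
  linear_combination this / 2

theorem mapC_mk {S : PhaseSpace.{u}} {T : PhaseSpace.{v}} (f : S.carrier →ₗ[ℝ] T.carrier)
    (a : ℂ) (x : S.carrier) : mapC f (Cx.mk a x) = Cx.mk a (f x) :=
  rfl

theorem formC_mapC_left {S : PhaseSpace.{u}} {T : PhaseSpace.{v}} {f : S.carrier →ₗ[ℝ] T.carrier}
    {g : T.carrier →ₗ[ℝ] S.carrier} (h : ∀ x y, T.form (f x) y = S.form x (g y)) (x : S.Cx)
    (y : T.Cx) : T.formC (mapC f x) y = S.formC x (mapC g y) := by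
  induction x using Cx.induction with
  | h0 => simp
  | ha x x' hx hx' =>
    rw [map_add, map_add, LinearMap.add_apply, hx, hx', map_add, LinearMap.add_apply]
  | ht a x =>
    induction y using Cx.induction with
    | h0 => simp
    | ha y y' hy hy' => rw [map_add, map_add, hy, hy', map_add]
    | ht b y => rw [mapC_mk, mapC_mk, formC_mk, formC_mk, h]

theorem mapC_mapC {S : PhaseSpace.{u}} {T : PhaseSpace.{v}} {R : PhaseSpace.{w}}
    (g : T.carrier →ₗ[ℝ] R.carrier) (f : S.carrier →ₗ[ℝ] T.carrier) (x : S.Cx) :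
    mapC g (mapC f x) = mapC (g ∘ₗ f) x := by
  induction x using Cx.induction with
  | h0 => simp
  | ha x x' hx hx' => simp only [map_add, hx, hx']
  | ht a x => rfl

theorem mapC_add {S : PhaseSpace.{u}} {T : PhaseSpace.{v}} (f g : S.carrier →ₗ[ℝ] T.carrier)
    (x : S.Cx) : mapC (f + g) x = mapC f x + mapC g x :=
  LinearMap.congr_fun (LinearMap.baseChange_add (A := ℂ) f g) x

theorem mapC_neg {S : PhaseSpace.{u}} {T : PhaseSpace.{v}} (f : S.carrier →ₗ[ℝ] T.carrier)
    (x : S.Cx) : mapC (-f) x = -mapC f x :=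
  LinearMap.congr_fun (LinearMap.baseChange_neg (A := ℂ) f) x

theorem mapC_zero {S : PhaseSpace.{u}} {T : PhaseSpace.{v}} (x : S.Cx) :
    mapC (0 : S.carrier →ₗ[ℝ] T.carrier) x = 0 :=
  LinearMap.congr_fun (LinearMap.baseChange_zero (A := ℂ)) x

theorem mapC_id {S : PhaseSpace.{u}} (x : S.Cx) :
    mapC (LinearMap.id : S.carrier →ₗ[ℝ] S.carrier) x = x := by
  induction x using Cx.induction with
  | h0 => simp
  | ha x x' hx hx' => rw [map_add, hx, hx']
  | ht a x => rfl

section Triple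

variable {S₁ : PhaseSpace.{u}} {S : PhaseSpace.{v}}

theorem formC_triple (a : S₁.Cx) (b c : S.Cx) (z : (glued S₁ S).Cx) :
    (glued S₁ S).formC (triple a b c) z =
      S₁.formC a (projFst S₁ S z) + S.formC b (projMid S₁ S z) - S.formC c (projLast S₁ S z) := by
  rw [triple, map_add, map_add, LinearMap.add_apply, LinearMap.add_apply, sub_eq_add_neg]
  congr 1
  · congr 1
    · refine formC_mapC_left (fun x y ↦ ?_) a z
      exact (show ∀ (u : S₁.carrier) (v w : S.carrier),
        S₁.form x u + (S.form 0 v + -S.form 0 w) = S₁.form x u by simp) y.1 y.2.1 y.2.2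
    · refine formC_mapC_left (fun x y ↦ ?_) b z
      exact (show ∀ (u : S₁.carrier) (v w : S.carrier),
        S₁.form 0 u + (S.form x v + -S.form 0 w) = S.form x v by simp) y.1 y.2.1 y.2.2
  · rw [← map_neg, projLast, ← mapC_neg]
    refine formC_mapC_left (fun x y ↦ ?_) c z
    exact (show ∀ (u : S₁.carrier) (v w : S.carrier),
      S₁.form 0 u + (S.form 0 v + -S.form x w) = S.form x (-w) by simp) y.1 y.2.1 y.2.2

theorem triple_proj (z : (glued S₁ S).Cx) :
    triple (projFst S₁ S z) (projMid S₁ S z) (projLast S₁ S z) = z := by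
  rw [triple, projFst, projMid, projLast, mapC_mapC, mapC_mapC, mapC_mapC, ← mapC_add, ← mapC_add]
  conv_rhs => rw [← mapC_id z]
  congr 1
  congr 1
  refine LinearMap.ext fun x ↦ Prod.ext ?_ (Prod.ext ?_ ?_)
  · change x.1 + 0 + 0 = x.1
    simp
  · change 0 + x.2.1 + 0 = x.2.1
    simp
  · change 0 + 0 + x.2.2 = x.2.2
    simp

theorem projMid_triple (a : S₁.Cx) (b c : S.Cx) : projMid S₁ S (triple a b c) = b := by
  rw [triple, projMid, map_add, map_add, mapC_mapC, mapC_mapC, mapC_mapC]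
  refine (congrArg₂ (· + ·) (congrArg₂ (· + ·) (mapC_zero a) (mapC_id b)) (mapC_zero c)).trans ?_
  simp

theorem projLast_triple (a : S₁.Cx) (b c : S.Cx) : projLast S₁ S (triple a b c) = c := by
  rw [triple, projLast, map_add, map_add, mapC_mapC, mapC_mapC, mapC_mapC]
  refine (congrArg₂ (· + ·) (congrArg₂ (· + ·) (mapC_zero a) (mapC_zero b)) (mapC_id c)).trans ?_
  simp

theorem triple_add (a a' : S₁.Cx) (b b' c c' : S.Cx) :
    triple (a + a') (b + b') (c + c') = triple a b c + triple a' b' c' := by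
  simp only [triple, map_add]
  abel

theorem triple_sub (a a' : S₁.Cx) (b b' c c' : S.Cx) :
    triple (a - a') (b - b') (c - c') = triple a b c - triple a' b' c' := by
  simp only [triple, map_sub]
  abel

variable (S₁ S) in
/-- The diagonal `ξ ↦ (0, ξ, ξ)`. -/
noncomputable def diagonal : S.Cx →ₗ[ℂ] (glued S₁ S).Cx where
  toFun ξ := triple 0 ξ ξ
  map_add' x y := by rw [← triple_add, add_zero]
  map_smul' c x := by simp [triple]

theorem diagonal_apply (ξ : S.Cx) : diagonal S₁ S ξ = triple 0 ξ ξ := rfl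

/-- The contributions of `Σ` and `Σ̄'` cancel by their opposite orientations. -/
theorem formC_diagonal {z : (glued S₁ S).Cx} (hz : projMid S₁ S z = projLast S₁ S z) (ξ : S.Cx) :
    (glued S₁ S).formC (diagonal S₁ S ξ) z = 0 := by
  rw [diagonal_apply, formC_triple, hz]
  simp

end Triple

end PhaseSpace

/-! ## Correlation functions -/

namespace Region

variable {S : PhaseSpace.{u}} {M : Region.{u, v} S}

theorem bdry_solution_sub_mem (P : M.Polarization) (D : M.linObs) (ζ : S.Cx) :
    M.bdry D (solution P D ζ) - ζ ∈ P.carrier :=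
  (existsUnique_solution P D ζ).choose_spec.1

theorem eq_solution (P : M.Polarization) {D : M.linObs} {ζ : S.Cx} {η : M.A D}
    (h : M.bdry D η - ζ ∈ P.carrier) : solution P D ζ = η :=
  (existsUnique_solution P D ζ).unique (bdry_solution_sub_mem P D ζ) h

/-- The projection to the interior solutions along the polarization. -/
noncomputable def interiorProj (P : M.Polarization) : S.Cx →ₗ[ℂ] S.Cx :=
  M.interior.projection P.carrier P.transversal

theorem exists_r_eq_interiorProj (P : M.Polarization) (ζ : S.Cx) :
    ∃ φ : M.Sol, M.r φ = interiorProj P ζ :=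
  Submodule.projection_apply_mem P.transversal ζ

theorem sub_interiorProj_mem (P : M.Polarization) (ζ : S.Cx) :
    ζ - interiorProj P ζ ∈ P.carrier :=
  Submodule.sub_projection_mem P.transversal ζ

/-- The form `ω(ζ, π ζ')`, with `π` the projection to the interior along the polarization. -/
noncomputable def polarForm (P : M.Polarization) : LinearMap.BilinForm ℂ S.Cx :=
  S.formC.compl₂ (interiorProj P)

theorem polarForm_apply (P : M.Polarization) (ζ ζ' : S.Cx) :
    polarForm P ζ ζ' = S.formC ζ (interiorProj P ζ') := rfl

/-- Expand `ω(ζ - π ζ, ζ' - π ζ') = 0` (the polarization is isotropic) and use `ω(π ζ, π ζ') = 0`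
(so is the interior). -/
theorem polarForm_sub_swap (P : M.Polarization) (ζ ζ' : S.Cx) :
    polarForm P ζ ζ' = S.formC ζ ζ' + polarForm P ζ' ζ := by
  have h1 := P.lagrangian.1 _ (sub_interiorProj_mem P ζ) _ (sub_interiorProj_mem P ζ')
  have h2 := M.r_lagrangian.1 _ (exists_r_eq_interiorProj P ζ) _ (exists_r_eq_interiorProj P ζ')
  have h3 := S.formC_swap (interiorProj P ζ) ζ'
  simp only [map_sub, LinearMap.sub_apply] at h1
  rw [polarForm_apply, polarForm_apply]
  linear_combination -h1 + h2 - h3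

theorem corr_eq (P : M.Polarization) (D : M.linObs) (ζ : S.Cx) :
    corr P D ζ = Complex.exp (Complex.I / 2 * (D.1 (solution P D ζ : M.Conf) +
      2 * S.formC ζ (M.bdry D (solution P D ζ)))) := by
  rw [corr, sliceObs]
  congr 3
  simp only [map_smul, map_add, map_sub, PhaseSpace.formC_self, smul_eq_mul]
  ring

/-- The dependence of correlation functions on the boundary Weyl observable. -/
theorem corr_add (P : M.Polarization) (D : M.linObs) (ζ ζ' : S.Cx) :
    corr P D (ζ + ζ') = corr P D ζ * Complex.exp (Complex.I *
      (2 * S.formC ζ' (M.bdry D (solution P D ζ)) - S.formC ζ' ζ + polarForm P ζ' ζ')) := by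
  obtain ⟨φ, hφ⟩ := exists_r_eq_interiorProj P ζ'
  set η := solution P D ζ with hη
  have hmem : (η : M.Conf) + φ ∈ M.A D := by
    have := AffineSubspace.vadd_mem_of_mem_direction
      (s := M.A D) (v := (φ : M.Conf)) (by rw [M.A_direction]; exact φ.2) η.2
    rwa [vadd_eq_add, add_comm] at this
  have hb := M.bdry_add D η ⟨_, hmem⟩ φ rfl
  -- Shifting the boundary datum by `ζ'` moves the solution by the homogeneous solution with
  -- boundary value `π ζ'`.
  have hs : solution P D (ζ + ζ') = ⟨_, hmem⟩ := by
    refine eq_solution P ?_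
    rw [hb, hφ, show M.bdry D η + interiorProj P ζ' - (ζ + ζ') =
      (M.bdry D η - ζ) - (ζ' - interiorProj P ζ') by abel]
    exact P.carrier.sub_mem (bdry_solution_sub_mem P D ζ) (sub_interiorProj_mem P ζ')
  have h1 := P.lagrangian.1 _ (sub_interiorProj_mem P ζ') _ (bdry_solution_sub_mem P D ζ)
  have h2 := M.obs_eq D φ η
  have h3 := S.formC_swap (interiorProj P ζ') ζ
  rw [← hη] at h1
  rw [corr_eq, corr_eq, hs, hb, hφ, ← hη, ← Complex.exp_add]
  rw [hφ] at h2
  congr 1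
  simp only [map_add, LinearMap.add_apply, h2, polarForm_apply]
  simp only [map_sub, LinearMap.sub_apply] at h1
  linear_combination -Complex.I * h1 + Complex.I * h3

theorem bdry_solution_zero (P : M.Polarization) : M.bdry 0 (solution P 0 0) = 0 := by
  have h1 := bdry_solution_sub_mem P 0 0
  rw [sub_zero] at h1
  have hA : ∀ x ∈ M.A 0, x ∈ M.Sol := fun x hx ↦ by
    rw [M.A_zero] at hx
    exact hx
  have h2 := hA _ (solution P 0 0).2
  have h3 := M.bdry_zero (solution P 0 0) ⟨_, h2⟩ rfl
  have h4 : M.bdry 0 (solution P 0 0) ∈ M.interior ⊓ P.carrier := ⟨⟨_, h3.symm⟩, h1⟩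
  rwa [P.transversal.inf_eq_bot, Submodule.mem_bot] at h4

theorem corr_zero_eq (P : M.Polarization) (ζ : S.Cx) :
    corr P 0 ζ = Complex.exp (Complex.I * polarForm P ζ ζ) := by
  have h := corr_add P 0 0 ζ
  rw [zero_add, bdry_solution_zero] at h
  rw [h, corr_eq]
  simp

end Region

/-! ### Completing the square at the critical point -/

namespace Gluing

open PhaseSpace Region

variable {S₁ S : PhaseSpace.{u}} {M : Region.{u, v} (PhaseSpace.glued S₁ S)}
  {M₁ : Region.{u, w} S₁}

/-- The correlation functions of the glued region are those of the original region at the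
critical point of the gluing, where the boundary values on the two copies of `Σ` agree. -/
theorem exists_critical_point (G : Gluing M M₁) (P : M.Polarization) (P₁ : M₁.Polarization)
    (hext : ∀ φ ∈ P₁.carrier, ∃ ψ : S.Cx, triple φ ψ ψ ∈ P.carrier) (D : M.linObs) (φ : S₁.Cx) :
    ∃ ξ₀ : S.Cx, corr P D (triple φ ξ₀ ξ₀) = corr P₁ (G.induced D) φ ∧
      projMid S₁ S (M.bdry D (solution P D (triple φ ξ₀ ξ₀))) =
        projLast S₁ S (M.bdry D (solution P D (triple φ ξ₀ ξ₀))) := by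
  set η₁ : M₁.A (G.induced D) := solution P₁ (G.induced D) φ with hη₁
  set η : M.A D := ⟨G.k η₁, G.mapsTo D η₁⟩
  have hfst : projFst S₁ S (M.bdry D η) = M₁.bdry _ η₁ := G.proj_bdry D η₁
  have hagree : projMid S₁ S (M.bdry D η) = projLast S₁ S (M.bdry D η) :=
    (G.exact D η).2 ⟨η₁, rfl⟩
  obtain ⟨ψ, hψ⟩ := hext _ (bdry_solution_sub_mem P₁ (G.induced D) φ)
  -- With this choice the jump of `η` is the jump of `η₁` extended by `(ψ, ψ)`, which lies in `P`.
  set ξ₀ := projMid S₁ S (M.bdry D η) - ψ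
  have hs : solution P D (triple φ ξ₀ ξ₀) = η := by
    refine eq_solution P ?_
    have h1 := triple_proj (M.bdry D η)
    rw [← hagree, hfst] at h1
    rw [← h1, ← triple_sub, sub_sub_cancel]
    exact hψ
  refine ⟨ξ₀, ?_, by rw [hs]; exact hagree⟩
  rw [corr_eq, corr_eq, hs, formC_triple, hfst, hagree, add_sub_cancel_right]
  rfl

/-- In `corr_add` at `(φ, ξ₀, ξ₀)` the linear term vanishes because the components of the solution
on the two copies of `Σ` agree. Only the quadratic term remains, and it is the observable-free
amplitude. -/
theorem corr_diagonal (G : Gluing M M₁) (P : M.Polarization) (P₁ : M₁.Polarization)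
    (hext : ∀ φ ∈ P₁.carrier, ∃ ψ : S.Cx, triple φ ψ ψ ∈ P.carrier) (D : M.linObs) (φ : S₁.Cx) :
    ∃ ξ₀ : S.Cx, ∀ ξ : S.Cx, corr P D (triple φ ξ ξ) = corr P₁ (G.induced D) φ *
      corr P 0 (triple 0 (ξ - ξ₀) (ξ - ξ₀)) := by
  obtain ⟨ξ₀, h1, h2⟩ := exists_critical_point G P P₁ hext D φ
  refine ⟨ξ₀, fun ξ ↦ ?_⟩
  have h3 : triple φ ξ ξ = triple φ ξ₀ ξ₀ + diagonal S₁ S (ξ - ξ₀) := by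
    rw [diagonal_apply, ← triple_add, add_zero, add_sub_cancel]
  have h4 : projMid S₁ S (triple φ ξ₀ ξ₀) = projLast S₁ S (triple φ ξ₀ ξ₀) := by
    rw [projMid_triple, projLast_triple]
  rw [h3, corr_add, formC_diagonal h2, formC_diagonal h4, h1, corr_zero_eq, diagonal_apply]
  simp

end Gluing

/-- Needed because the critical point `ξ₀` is in general not fixed by `α`. -/
theorem RealStructure.exists_add_I_smul {V : Type u} [AddCommGroup V] [Module ℂ V]
    (α : RealStructure V) (x : V) : ∃ a b : α.fixed, x = a + Complex.I • (b : V) := by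
  have hα : α.toMap (α.toMap x) = x := α.involutive x
  refine ⟨⟨(1 / 2 : ℂ) • (x + α.toMap x), ?_⟩,
    ⟨(-(Complex.I / 2)) • (x - α.toMap x), ?_⟩, ?_⟩
  · change α.toMap _ = _
    rw [LinearMap.map_smulₛₗ, map_add, hα, add_comm]
    simp [map_ofNat (starRingEnd ℂ) 2]
  · change α.toMap _ = _
    rw [LinearMap.map_smulₛₗ, map_sub, hα, ← neg_sub x, smul_neg, ← neg_smul]
    simp [neg_div, map_ofNat (starRingEnd ℂ) 2]
  · simp only
    rw [smul_smul, show Complex.I * -(Complex.I / 2) = 1 / 2 by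
      linear_combination -(1 / 2 : ℂ) * Complex.I_sq, ← smul_add]
    rw [add_add_sub_cancel, ← two_smul ℂ x, smul_smul]
    norm_num

/-! ### The gluing integrand as a translated Gaussian -/

section Composition

open PhaseSpace Region HatSpace

variable {S₁ S : PhaseSpace.{u}} {M : Region.{u, v} (PhaseSpace.glued S₁ S)}
  {M₁ : Region.{u, w} S₁}

/-- The complex quadratic form of the gluing integral. -/
noncomputable def gluingForm (P : M.Polarization) : LinearMap.BilinForm ℂ S.Cx :=
  (-2 * Complex.I) • (polarForm P).compl₁₂ (diagonal S₁ S) (diagonal S₁ S)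

theorem gluingForm_apply (P : M.Polarization) (x y : S.Cx) : gluingForm P x y =
    -2 * Complex.I * polarForm P (diagonal S₁ S x) (diagonal S₁ S y) := rfl

/-- The antisymmetric part of `polarForm` is half of `ω`, which vanishes on the diagonal. -/
theorem gluingForm_symm (P : M.Polarization) (x y : S.Cx) :
    gluingForm P x y = gluingForm P y x := by
  rw [gluingForm_apply, gluingForm_apply, polarForm_sub_swap, formC_diagonal, zero_add]
  rw [diagonal_apply, projMid_triple, projLast_triple]

/-- The factor `-2 i` in `gluingForm` is chosen for this Gaussian normalization. -/
theorem corr_zero_diagonal (P : M.Polarization) (ξ : S.Cx) :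
    corr P 0 (triple 0 ξ ξ) = Complex.exp (-gluingForm P ξ ξ / 2) := by
  rw [corr_zero_eq, gluingForm_apply, diagonal_apply]
  congr 1
  ring

variable {α : RealStructure S.Cx} {H : Type u} [NormedAddCommGroup H] [InnerProductSpace ℝ H]

/-- The restriction of a complex bilinear form to the fixed space of a real structure. -/
noncomputable def realRestriction (e : H ≃ₗ[ℝ] α.fixed) (Q : LinearMap.BilinForm ℂ S.Cx) :
    H →ₗ[ℝ] H →ₗ[ℝ] ℂ :=
  LinearMap.mk₂ ℝ (fun x y ↦ Q (e x : S.Cx) (e y : S.Cx)) (by simp)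
    (fun c x y ↦ by
      have : ((e (c • x) : α.fixed) : S.Cx) = (c : ℂ) • (e x : S.Cx) := by rw [map_smul]; rfl
      rw [this]; simp)
    (by simp)
    (fun c x y ↦ by
      have : ((e (c • y) : α.fixed) : S.Cx) = (c : ℂ) • (e y : S.Cx) := by rw [map_smul]; rfl
      rw [this]; simp)

theorem glueIntegrand_zero (P : M.Polarization) (e : H ≃ₗ[ℝ] α.fixed) :
    glueIntegrand P e 0 0 = gaussFn (realRestriction e (gluingForm P)) := by
  funext ξ
  rw [glueIntegrand, corr_zero_diagonal, gaussFn, ← Complex.exp_add]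
  congr 1
  change _ = -(gluingForm P (e ξ : S.Cx) (e ξ : S.Cx)) / 2 + _
  ring

theorem exists_glueIntegrand_eq (G : Gluing M M₁) (P : M.Polarization) (P₁ : M₁.Polarization)
    (hext : ∀ φ ∈ P₁.carrier, ∃ ψ : S.Cx, triple φ ψ ψ ∈ P.carrier) (e : H ≃ₗ[ℝ] α.fixed)
    (D : M.linObs) (φ : S₁.Cx) : ∃ a b : H, glueIntegrand P e D φ = fun ξ ↦
      corr P₁ (G.induced D) φ * complexShift (realRestriction e (gluingForm P)) a b ξ := by
  obtain ⟨ξ₀, hξ₀⟩ := G.corr_diagonal P P₁ hext D φ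
  obtain ⟨a, b, hab⟩ := α.exists_add_I_smul ξ₀
  refine ⟨e.symm a, e.symm b, funext fun ξ ↦ ?_⟩
  rw [glueIntegrand, hξ₀, mul_assoc, corr_zero_diagonal, complexShift, gaussFn, ← Complex.exp_add,
    ← Complex.exp_add]
  congr 2
  have hr : ∀ x y : H, realRestriction e (gluingForm P) x y =
    gluingForm P (e x : S.Cx) (e y : S.Cx) := fun _ _ ↦ rfl
  simp only [hr, LinearEquiv.apply_symm_apply, hab, map_add, map_sub, map_smul,
    LinearMap.add_apply, LinearMap.sub_apply, LinearMap.smul_apply, smul_eq_mul]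
  rw [gluingForm_symm P a (e ξ), gluingForm_symm P b (e ξ), gluingForm_symm P b a]
  linear_combination (-(gluingForm P (b : S.Cx) (b : S.Cx)) / 2) * Complex.I_sq

end Composition

theorem theorem6p1 {S₁ S : PhaseSpace.{u}} {M : Region.{u, v} (PhaseSpace.glued S₁ S)}
    {M₁ : Region.{u, w} S₁} (G : Gluing M M₁) (P : M.Polarization) (P₁ : M₁.Polarization)
    (hext : ∀ φ ∈ P₁.carrier, ∃ ψ : S.Cx, PhaseSpace.triple φ ψ ψ ∈ P.carrier)
    (α : RealStructure S.Cx) {H : Type u} [NormedAddCommGroup H] [InnerProductSpace ℝ H]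
    [CompleteSpace H] [TopologicalSpace.SeparableSpace H] (e : H ≃ₗ[ℝ] α.fixed)
    (hadm : AdmissibleGluing P e) (D : M.linObs) (φ : S₁.Cx) :
    (gluingAnomaly P e ≠ 0 → HatSpace.HatIntegrable (glueIntegrand P e D φ)) ∧
      (HatSpace.HatIntegrable (glueIntegrand P e D φ) →
        Region.corr P₁ (G.induced D) φ * gluingAnomaly P e =
          HatSpace.hatIntegral (glueIntegrand P e D φ)) := by
  obtain ⟨a, b, hab⟩ := exists_glueIntegrand_eq G P P₁ hext e D φ
  have hsymm : ∀ x y : H, realRestriction e (gluingForm P) x y =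
    realRestriction e (gluingForm P) y x := fun _ _ ↦ gluingForm_symm P _ _
  have hρ : Region.corr P₁ (G.induced D) φ ≠ 0 := Complex.exp_ne_zero _
  rw [AdmissibleGluing, glueIntegrand_zero] at hadm
  rw [gluingAnomaly, glueIntegrand_zero, hab]
  refine ⟨fun hc ↦ (HatSpace.hatIntegrable_complexShift hsymm hadm hc a b).const_mul _,
    fun hi ↦ (HatSpace.hatIntegral_complexShift hsymm hadm ?_ _).symm⟩
  -- The prefactor is an exponential, hence nonzero; dividing by it recovers integrability of the
  -- translated Gaussian itself.
  have := hi.const_mul (Region.corr P₁ (G.induced D) φ)⁻¹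
  simpa only [inv_mul_cancel_left₀ hρ] using this
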